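/- **Theorem (Grinberg–Kazhdan–Drinfeld formal arc theorem).** Let $k$ be a field (of arbitrary characteristic; in particular of characteristic $0$). A *test ring* is a local commutative $k$-algebra $A$ with nilpotent maximal ideal $\mathfrak n$ and residue field $k$. Formal neighbourhoods are described by their functors of points on test rings, and $\cong$ means isomorphism of functors on test rings: * for a $k$-scheme $Z$ and a $k$-rational point $z$, $Z[z](A)$ is the set of $k$-morphisms $\operatorname{Spec}A\to Z$ whose reduction modulo $\mathfrak n$ is $z$; * for a $k$-scheme $X$ and a $k$-arc $\gamma_0:\operatorname{Spec}k[[t]]\to X$, the formal neighbourhood $X_\infty[\gamma_0]$ of the arc space $X_\infty$ at $\gamma_0$ has as $A$-points the $k$-morphisms $\operatorname{Spec}A[[t]]\to X$ whose reduction modulo $\mathfrak n$ is $\gamma_0$; * $D^\infty$ is the product of countably infinitely many (indexed by $\mathbb N$) copies of the formal disc $D=\operatorname{Spf}k[[t]]$, where $D(A)$ is the set of continuous $k$-algebra homomorphisms $k[[t]]\to A$ ($A$ discrete). (1) Let $X$ be a scheme of finite type over $k$, $\operatorname{Sing}X$ the set of points at which $X$ is not smooth over $k$, and $\gamma_0$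 a $k$-arc of $X$ which does not lie in $(\operatorname{Sing}X)_\infty$, i.e. whose image is not contained in $\operatorname{Sing}X$. Assume that the point $\gamma_0(0)$ is not an isolated point of $X$ (i.e. $\{\gamma_0(0)\}$ is not open in $X$). Then there are a scheme $Y$ of finite type over $k$ and a $k$-rational point $y$ of $Y$ such that $$X_\infty[\gamma_0]\;\cong\; Y[y]\times D^\infty .$$ (2) Let $X=V(f)$ be an affine hypersurface, $f\in k[x_1,\dots,x_n,y]$, let $\gamma_0=(x_0,y_0)\in k[[t]]^{n}\times k[[t]]$ satisfy $f(x_0,y_0)=0$ and $\operatorname{ord}_t\,\partial_yf(x_0,y_0)=d$ with $0<d<\infty$, and let $r>1$ be an integer. Here $X_\infty[\gamma_0](A)$ is the set of $\gamma\in A[[t]]^{n+1}$ with $f(\gamma)=0$ and $\gamma\equiv\gamma_0$ mod $\mathfrak n$. Then there is an affine scheme $Y$ of finite type over $k$ which represents the functor sending a $k$-algebra $R$ to the set of triples $(q,\bar x,\bar y)\in R[t]\times R[t]^n\times R[t]$ such that $q$ is monic of degree $d$ (that is, $\deg(q-t^d)<d$), $\deg\bar x_i<(r+1)d$, $\deg\bar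 y<rd$, and $$\partial_yf(\bar x,\bar y)\equiv 0 \bmod q,\qquad f(\bar x,\bar y)\equiv 0\bmod q^{\,r+1};$$ the triple $\bigl(t^d,\;x_0\bmod (t)^{(r+1)d},\;y_0\bmod (t)^{rd}\bigr)$, with residues represented by truncations, is a point $y\in Y(k)$; and for this $y$ $$X_\infty[\gamma_0]\;\cong\; Y[y]\times D^\infty .$$ -/

import Mathlib

open CategoryTheory AlgebraicGeometry
open scoped PowerSeries Polynomial

universe u

noncomputable section

/-- A test ring over the field `k`: a local commutative `k`-algebra whose maximal ideal is
nilpotent and whose residue field is `k`. -/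
structure TestRing (k : Type u) [Field k] where
  carrier : Type u
  [commRing : CommRing carrier]
  [algebra : Algebra k carrier]
  [isLocalRing : IsLocalRing carrier]
  isNilpotent : IsNilpotent (IsLocalRing.maximalIdeal carrier)
  bijective_residue :
    Function.Bijective (algebraMap k (IsLocalRing.ResidueField carrier))

namespace TestRing

instance (k : Type u) [Field k] : CoeSort (TestRing k) (Type u) := ⟨carrier⟩

attribute [instance] commRing algebra isLocalRing

/-- Morphisms of test rings are the `k`-algebra homomorphisms (they are automatically local). -/
instance category (k : Type u) [Field k] : Category.{u} (TestRing k) where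
  Hom A B := A →ₐ[k] B
  id A := AlgHom.id k A
  comp f g := g.comp f

/-- The `k`-algebra homomorphism underlying a morphism of test rings. -/
def algHom {k : Type u} [Field k] {A B : TestRing k} (f : A ⟶ B) : A →ₐ[k] B := f

theorem algHom_id {k : Type u} [Field k] (A : TestRing k) :
    algHom (𝟙 A) = AlgHom.id k A := rfl

theorem algHom_comp {k : Type u} [Field k] {A B C : TestRing k} (f : A ⟶ B) (g : B ⟶ C) :
    algHom (f ≫ g) = (algHom g).comp (algHom f) := rfl

/-- Reduction modulo the maximal ideal, `A → A / 𝔫 = k`. -/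
def reduction {k : Type u} [Field k] (A : TestRing k) : A →ₐ[k] k :=
  (AlgEquiv.ofBijective (Algebra.ofId k (IsLocalRing.ResidueField A))
    A.bijective_residue).symm.toAlgHom.comp
    (IsScalarTower.toAlgHom k A (IsLocalRing.ResidueField A))

/-- The reduction is the only `k`-algebra homomorphism `A → k`. -/
theorem eq_reduction {k : Type u} [Field k] (A : TestRing k) (φ : A →ₐ[k] k) :
    φ = A.reduction := by
  have key : ∀ (ψ : A →ₐ[k] k) (a : A), a ∈ IsLocalRing.maximalIdeal A → ψ a = 0 := by
    intro ψ a ha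
    by_contra h
    have hu : IsUnit (a - algebraMap k A (ψ a)) := by
      have h1 : IsUnit (algebraMap k A (ψ a)) := (IsUnit.mk0 _ h).map _
      by_contra h2
      have h3 := (IsLocalRing.mem_maximalIdeal _).2 h2
      have h4 := Ideal.sub_mem _ ha h3
      rw [sub_sub_cancel] at h4
      exact (IsLocalRing.mem_maximalIdeal _).1 h4 h1
    have := hu.map ψ
    simp at this
  ext a
  obtain ⟨c, hc⟩ := A.bijective_residue.2 (IsLocalRing.residue A a)
  have hm : a - algebraMap k A c ∈ IsLocalRing.maximalIdeal A := by
    rw [← IsLocalRing.residue_eq_zero_iff, map_sub, ← hc, sub_eq_zero]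
    rfl
  have h1 := key φ _ hm
  have h2 := key A.reduction _ hm
  rw [map_sub, AlgHom.commutes, sub_eq_zero] at h1 h2
  rw [h1, h2]

theorem reduction_comp {k : Type u} [Field k] {A B : TestRing k} (f : A ⟶ B) :
    B.reduction.comp (algHom f) = A.reduction :=
  A.eq_reduction _

end TestRing

/-- The morphism `Spec S ⟶ Spec R` of `k`-schemes induced by a `k`-algebra homomorphism
`R → S`. -/
def specMap {k : Type u} [Field k] {R S : Type u} [CommRing R] [Algebra k R] [CommRing S]
    [Algebra k S] (φ : R →ₐ[k] S) : Spec (.of S) ⟶ Spec (.of R) :=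
  Spec.map (CommRingCat.ofHom φ.toRingHom)

/-- The structure morphism `Spec R ⟶ Spec k` of a `k`-algebra `R`. -/
def specStr (k : Type u) [Field k] (R : Type u) [CommRing R] [Algebra k R] :
    Spec (.of R) ⟶ Spec (.of k) :=
  Spec.map (CommRingCat.ofHom (algebraMap k R))

theorem specMap_id {k : Type u} [Field k] {R : Type u} [CommRing R] [Algebra k R] :
    specMap (AlgHom.id k R) = 𝟙 _ :=
  Spec.map_id _

theorem specMap_comp {k : Type u} [Field k] {R S T : Type u} [CommRing R] [Algebra k R]
    [CommRing S] [Algebra k S] [CommRing T] [Algebra k T] (ψ : S →ₐ[k] T) (φ : R →ₐ[k] S) :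
    specMap (ψ.comp φ) = specMap ψ ≫ specMap φ :=
  Spec.map_comp (CommRingCat.ofHom φ.toRingHom) (CommRingCat.ofHom ψ.toRingHom)

theorem specMap_str {k : Type u} [Field k] {R S : Type u} [CommRing R] [Algebra k R]
    [CommRing S] [Algebra k S] (φ : R →ₐ[k] S) : specMap φ ≫ specStr k R = specStr k S := by
  have h := congrArg (fun g => Spec.map (CommRingCat.ofHom g)) φ.comp_algebraMap
  exact (Spec.map_comp (CommRingCat.ofHom (algebraMap k R))
    (CommRingCat.ofHom φ.toRingHom)).symm.trans h

theorem mapAlgHom_id {k : Type u} [Field k] {A : Type u} [CommRing A] [Algebra k A] :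
    PowerSeries.mapAlgHom (AlgHom.id k A) = AlgHom.id k A⟦X⟧ := by
  ext p m
  simp [PowerSeries.mapAlgHom_apply]

theorem mapAlgHom_comp {k : Type u} [Field k] {A B C : Type u} [CommRing A] [Algebra k A]
    [CommRing B] [Algebra k B] [CommRing C] [Algebra k C] (ψ : B →ₐ[k] C) (φ : A →ₐ[k] B) :
    PowerSeries.mapAlgHom (ψ.comp φ) =
      (PowerSeries.mapAlgHom ψ).comp (PowerSeries.mapAlgHom φ) := by
  ext p m
  simp [PowerSeries.mapAlgHom_apply]

/-- The formal neighbourhood of a `k`-scheme `Z` at a `k`-rational point `z`, through its functor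
of points: it sends a test ring `A` to the set of `A`-points of `Z` over `k` whose reduction
modulo the maximal ideal of `A` is `z`. -/
def formalNbhd {k : Type u} [Field k] {Z : Scheme.{u}} (s : Z ⟶ Spec (.of k))
    (z : Spec (.of k) ⟶ Z) : TestRing k ⥤ Type u where
  obj A := { φ : Spec (.of A) ⟶ Z // φ ≫ s = specStr k A ∧ specMap A.reduction ≫ φ = z }
  map {A B} f := TypeCat.ofHom fun φ =>
    ⟨specMap (TestRing.algHom f) ≫ φ.1, by rw [Category.assoc, φ.2.1, specMap_str], by
      rw [← Category.assoc, ← specMap_comp, TestRing.reduction_comp]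
      exact φ.2.2⟩
  map_id A := by
    refine TypeCat.homEquiv.injective (funext fun φ => Subtype.ext ?_)
    change specMap (AlgHom.id k A) ≫ φ.1 = φ.1
    rw [specMap_id, Category.id_comp]
  map_comp {A B C} f g := by
    refine TypeCat.homEquiv.injective (funext fun φ => Subtype.ext ?_)
    change specMap ((TestRing.algHom g).comp (TestRing.algHom f)) ≫ φ.1 =
      specMap (TestRing.algHom g) ≫ specMap (TestRing.algHom f) ≫ φ.1
    rw [specMap_comp, Category.assoc]

/-- The formal neighbourhood `X_∞[γ₀]` of the arc space of a `k`-scheme `X` at a `k`-arc `γ₀`,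
through its functor of points: it sends a test ring `A` to the set of `A⟦t⟧`-points of `X` over
`k` whose reduction modulo the maximal ideal of `A` is `γ₀`. -/
def arcFormalNbhd {k : Type u} [Field k] {X : Scheme.{u}} (s : X ⟶ Spec (.of k))
    (γ₀ : Spec (.of k⟦X⟧) ⟶ X) : TestRing k ⥤ Type u where
  obj A := { γ : Spec (.of A⟦X⟧) ⟶ X // γ ≫ s = specStr k A⟦X⟧ ∧
    specMap (PowerSeries.mapAlgHom A.reduction) ≫ γ = γ₀ }
  map {A B} f := TypeCat.ofHom fun γ =>
    ⟨specMap (PowerSeries.mapAlgHom (TestRing.algHom f)) ≫ γ.1, by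
      rw [Category.assoc, γ.2.1, specMap_str], by
      rw [← Category.assoc, ← specMap_comp, ← mapAlgHom_comp, TestRing.reduction_comp]
      exact γ.2.2⟩
  map_id A := by
    refine TypeCat.homEquiv.injective (funext fun γ => Subtype.ext ?_)
    change specMap (PowerSeries.mapAlgHom (AlgHom.id k A)) ≫ γ.1 = γ.1
    rw [mapAlgHom_id, specMap_id, Category.id_comp]
  map_comp {A B C} f g := by
    refine TypeCat.homEquiv.injective (funext fun γ => Subtype.ext ?_)
    change specMap (PowerSeries.mapAlgHom ((TestRing.algHom g).comp (TestRing.algHom f))) ≫ γ.1 =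
      specMap (PowerSeries.mapAlgHom (TestRing.algHom g)) ≫
        specMap (PowerSeries.mapAlgHom (TestRing.algHom f)) ≫ γ.1
    rw [mapAlgHom_comp, specMap_comp, Category.assoc]

/-- The countable product `D^∞ = D^ℕ` of formal discs `D = Spf k⟦t⟧`, through its functor of
points on test rings. An `A`-point of `Spf k⟦t⟧` is a continuous `k`-algebra homomorphism
`k⟦t⟧ → A` (`A` discrete), that is, one which kills a power of `t`. -/
def formalDiscPow (k : Type u) [Field k] : TestRing k ⥤ Type u where
  obj A := ℕ → { φ : k⟦X⟧ →ₐ[k] A // ∃ N : ℕ, φ (PowerSeries.X ^ N) = 0 }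
  map {A B} f := TypeCat.ofHom fun φ i =>
    ⟨(TestRing.algHom f).comp (φ i).1, by
      obtain ⟨N, hN⟩ := (φ i).2
      exact ⟨N, by rw [AlgHom.comp_apply, hN, map_zero]⟩⟩
  map_id _ := rfl
  map_comp _ _ := rfl

/-- The singular locus of a `k`-scheme `X`: the set of points at which `X` is not smooth
over `k`. -/
def singularLocus {k : Type u} [Field k] {X : Scheme.{u}} (s : X ⟶ Spec (.of k)) : Set X :=
  { x | ¬ ∃ U : X.Opens, x ∈ U ∧ Smooth (U.ι ≫ s) }

/-- Combine `n` entries `x` and one entry `y` into a vector indexed by `Option (Fin n)`; the index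
`none` belongs to `y`. -/
def vec {R : Type u} {n : ℕ} (x : Fin n → R) (y : R) : Option (Fin n) → R :=
  fun i => i.elim y x

/-- The formal neighbourhood `X_∞[γ₀]` of the arc space of the affine hypersurface `X = V(f)`,
`f ∈ k[x₁, …, xₙ, y]`, at an arc `γ₀ = (x₀, y₀)`: it sends a test ring `A` to the set of
`γ = (x, y)` in `A⟦t⟧^(n+1)` with `f(x, y) = 0` whose reduction is `γ₀`. -/
def hypersurfaceArcFormalNbhd {k : Type u} [Field k] {n : ℕ} (f : MvPolynomial (Option (Fin n)) k)
    (x₀ : Fin n → k⟦X⟧) (y₀ : k⟦X⟧) : TestRing k ⥤ Type u where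
  obj A := { γ : Option (Fin n) → A⟦X⟧ // MvPolynomial.aeval γ f = 0 ∧
    ∀ i, PowerSeries.mapAlgHom A.reduction (γ i) = vec x₀ y₀ i }
  map {A B} g := TypeCat.ofHom fun γ =>
    ⟨fun i => PowerSeries.mapAlgHom (TestRing.algHom g) (γ.1 i), by
      have h := MvPolynomial.comp_aeval_apply γ.1 (PowerSeries.mapAlgHom (TestRing.algHom g)) f
      rw [γ.2.1, map_zero] at h
      exact h.symm, fun i => by
      change ((PowerSeries.mapAlgHom B.reduction).comp
        (PowerSeries.mapAlgHom (TestRing.algHom g))) (γ.1 i) = _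
      rw [← mapAlgHom_comp, TestRing.reduction_comp]
      exact γ.2.2 i⟩
  map_id A := by
    refine TypeCat.homEquiv.injective (funext fun γ => Subtype.ext (funext fun i => ?_))
    change PowerSeries.mapAlgHom (AlgHom.id k A) (γ.1 i) = γ.1 i
    rw [mapAlgHom_id, AlgHom.id_apply]
  map_comp {A B C} g h := by
    refine TypeCat.homEquiv.injective (funext fun γ => Subtype.ext (funext fun i => ?_))
    change PowerSeries.mapAlgHom ((TestRing.algHom h).comp (TestRing.algHom g)) (γ.1 i) =
      PowerSeries.mapAlgHom (TestRing.algHom h) (PowerSeries.mapAlgHom (TestRing.algHom g) (γ.1 i))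
    rw [mapAlgHom_comp, AlgHom.comp_apply]

/-- Triples `(q, x̄, ȳ)` over a `k`-algebra `R`: `q` is a monic polynomial of degree `d`, the
entries of `x̄` and `ȳ` are polynomials of degree `< (r+1)d` and `< rd`, and
`∂f/∂y (x̄, ȳ) ≡ 0 mod q`, `f(x̄, ȳ) ≡ 0 mod q^(r+1)`.
("Monic of degree `d`" is written as `q - t^d` having degree `< d`, which is the same unless
`R` is the zero ring.) -/
@[ext]
structure Triple {k : Type u} [Field k] {n : ℕ} (f : MvPolynomial (Option (Fin n)) k) (d r : ℕ)
    (R : Type u) [CommRing R] [Algebra k R] where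
  q : R[X]
  x : Fin n → R[X]
  y : R[X]
  q_mem : q - Polynomial.X ^ d ∈ Polynomial.degreeLT R d
  x_mem : ∀ i, x i ∈ Polynomial.degreeLT R ((r + 1) * d)
  y_mem : y ∈ Polynomial.degreeLT R (r * d)
  dvd_pderiv : q ∣ MvPolynomial.aeval (vec x y) (MvPolynomial.pderiv none f)
  dvd_eval : q ^ (r + 1) ∣ MvPolynomial.aeval (vec x y) f

theorem map_mem_degreeLT {R S : Type u} [CommRing R] [CommRing S] (φ : R →+* S) {m : ℕ}
    {p : R[X]} (hp : p ∈ Polynomial.degreeLT R m) : p.map φ ∈ Polynomial.degreeLT S m := by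
  rw [Polynomial.mem_degreeLT] at hp ⊢
  exact Polynomial.degree_map_le.trans_lt hp

theorem map_aeval_vec {k : Type u} [Field k] {n : ℕ} (f : MvPolynomial (Option (Fin n)) k)
    {R S : Type u} [CommRing R] [Algebra k R] [CommRing S] [Algebra k S] (φ : R →ₐ[k] S)
    (x : Fin n → R[X]) (y : R[X]) :
    (MvPolynomial.aeval (vec x y) f).map φ.toRingHom =
      MvPolynomial.aeval (vec (fun i => (x i).map φ.toRingHom) (y.map φ.toRingHom)) f := by
  have h := MvPolynomial.comp_aeval_apply (vec x y) (Polynomial.mapAlgHom φ) f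
  refine h.trans ?_
  congr 2
  funext i
  cases i <;> rfl

/-- Base change of triples, coefficientwise. -/
def Triple.map {k : Type u} [Field k] {n : ℕ} {f : MvPolynomial (Option (Fin n)) k} {d r : ℕ}
    {R S : Type u} [CommRing R] [Algebra k R] [CommRing S] [Algebra k S] (φ : R →ₐ[k] S)
    (T : Triple f d r R) : Triple f d r S where
  q := T.q.map φ.toRingHom
  x i := (T.x i).map φ.toRingHom
  y := T.y.map φ.toRingHom
  q_mem := by simpa using map_mem_degreeLT φ.toRingHom T.q_mem
  x_mem i := map_mem_degreeLT φ.toRingHom (T.x_mem i)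
  y_mem := map_mem_degreeLT φ.toRingHom T.y_mem
  dvd_pderiv := by
    rw [← map_aeval_vec]
    exact Polynomial.map_dvd _ T.dvd_pderiv
  dvd_eval := by
    rw [← map_aeval_vec, ← Polynomial.map_pow]
    exact Polynomial.map_dvd _ T.dvd_eval

/-- The functor `R ↦ Y(R)` of triples `(q, x̄, ȳ)`, on all `k`-algebras `R`. -/
def tripleFunctor {k : Type u} [Field k] {n : ℕ} (f : MvPolynomial (Option (Fin n)) k)
    (d r : ℕ) : CommAlgCat.{u} k ⥤ Type u where
  obj R := Triple f d r R
  map g := TypeCat.ofHom fun T => T.map g.hom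
  map_id R := by
    refine TypeCat.homEquiv.injective (funext fun T => ?_)
    change Triple.map (AlgHom.id k R) T = T
    ext i <;> simp [Triple.map]
  map_comp {R S T} g h := by
    refine TypeCat.homEquiv.injective (funext fun τ => ?_)
    change Triple.map (h.hom.comp g.hom) τ = Triple.map h.hom (Triple.map g.hom τ)
    ext i <;> simp [Triple.map]

end

/-! The argument is Drinfeld's. Suppose the arcs near `γ₀` are cut out by equations `f j = 0`, as
many as there are variables `y` (indexed by `τ`), the other variables `x` being indexed by `σ`, and
let the determinant of `∂f/∂y` have finite order `d` along `γ₀`. Over a test ring `A`, Weierstrass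
preparation writes its value along a deformation of `γ₀` as `q` times a unit, with `q` monic of
degree `d` reducing to `t^d`. Dividing `x` by `q^(r+1)` and `y` by `q^r` leaves polynomial
remainders of bounded degree. These remainders and `q` satisfy congruences modulo powers of `q`, and
conversely the congruences suffice: whatever quotients are prescribed for `x`, Newton's method
yields exactly one choice of quotients for `y` with the prescribed reduction that solves the
equations. Hence an arc amounts to a solution of the congruences, that is, a point of a scheme `Y`
of finite type, together with freely chosen power series, whose coefficients give `D^∞` as soon as
there is at least one variable `x`. The induction in Newton's method runs over powers of the
nilpotent kernel of `A⟦t⟧ → k⟦t⟧`, and multiplying the system by the adjugate of its Jacobian matrix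
makes its linear part scalar. The main lemmas are `exists_newton`, `eq_of_newton`,
`newtonSystem_dvd_of_congr`, `nonempty_liftNbhd_iso_arcPoints` and `nonempty_liftNbhd_iso_prod`.

A general `X` is first replaced by an affine chart, which contains the whole arc as soon as it
contains the origin of the arc. There the `f j` are relations whose differentials along `γ₀` form a
basis, over the field of Laurent series, of the span of the differentials of all relations. They may
fail to define `X`, but every deformation of `γ₀` that satisfies them satisfies all relations
(`aeval_eq_zero_of_adapted`): after inverting the non-zero-divisors of `A⟦t⟧`, formal smoothness
shows that the ideal `M` generated by the values of the relations satisfies `M ≤ N * M` with `N`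
nilpotent.

If no variable `x` remained, uniqueness in Newton's method would make `γ₀` invariant under `t ↦ (1 +
w)t` with `w` nilpotent, hence constant, and the Jacobian criterion at the constant value would make
`γ₀(0)` isolated (`isOpen_singleton_of_jac_ne_zero`). -/

noncomputable section

/-! ### Taylor expansion and Newton's method for the system multiplied by the adjugate. -/

namespace MvPolynomial

/-- First-order Taylor expansion of a polynomial, at the level of congruences: the value only
depends on the argument modulo an ideal. -/
theorem aeval_sub_aeval_mem {ι k T : Type*} [CommRing k] [CommRing T] [Algebra k T]
    (I : Ideal T) {c c' : ι → T} (h : ∀ i, c' i - c i ∈ I) (P : MvPolynomial ι k) :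
    aeval c' P - aeval c P ∈ I := by
  rw [← Ideal.Quotient.mk_eq_mk_iff_sub_mem]
  have hc : ∀ c : ι → T, Ideal.Quotient.mk I (aeval c P) =
      aeval (fun i => Ideal.Quotient.mkₐ k I (c i)) P :=
    fun c => MvPolynomial.comp_aeval_apply c (Ideal.Quotient.mkₐ k I) P
  rw [hc, hc]
  congr 2
  funext i
  exact (Ideal.Quotient.mk_eq_mk_iff_sub_mem _ _).2 (h i)

/-- Taylor expansion of a polynomial up to second order. -/
theorem aeval_taylor_mem {ι k T : Type*} [Fintype ι] [CommRing k] [CommRing T] [Algebra k T]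
    (I : Ideal T) {c c' : ι → T} (h : ∀ i, c' i - c i ∈ I) (P : MvPolynomial ι k) :
    aeval c' P - aeval c P - ∑ i, aeval c (pderiv i P) * (c' i - c i) ∈ I ^ 2 := by
  classical
  induction P using MvPolynomial.induction_on with
  | C a => simp
  | add p q hp hq =>
    convert Ideal.add_mem _ hp hq using 1
    simp only [map_add, add_mul, Finset.sum_add_distrib]
    ring
  | mul_X p j hp =>
    have h1 : ∑ i, aeval c (pderiv i (p * X j)) * (c' i - c i) =
        c j * ∑ i, aeval c (pderiv i p) * (c' i - c i) + aeval c p * (c' j - c j) := by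
      have : ∀ i, aeval c (pderiv i (p * X j)) * (c' i - c i) =
          c j * (aeval c (pderiv i p) * (c' i - c i)) +
            if i = j then aeval c p * (c' i - c i) else 0 := by
        intro i
        rw [Derivation.leibniz, pderiv_X]
        by_cases hij : i = j
        · subst hij; simp; ring
        · simp [hij, Ne.symm hij]; ring
      rw [Finset.sum_congr rfl fun i _ => this i, Finset.sum_add_distrib, ← Finset.mul_sum]
      simp
    rw [h1, map_mul, map_mul, aeval_X, aeval_X]
    have h2 : (aeval c' p - aeval c p) * (c' j - c j) ∈ I ^ 2 := by
      rw [pow_two]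
      exact Ideal.mul_mem_mul (aeval_sub_aeval_mem I h p) (h j)
    convert Ideal.add_mem _ (Ideal.mul_mem_left _ (c j) hp) h2 using 1
    ring

section Jacobian

variable {σ τ k : Type*} [Fintype τ] [DecidableEq τ] [Field k]

/-- The matrix of partial derivatives of `f` in the variables indexed by `τ`. -/
def jac (f : τ → MvPolynomial (σ ⊕ τ) k) : Matrix τ τ (MvPolynomial (σ ⊕ τ) k) :=
  Matrix.of fun i j => pderiv (Sum.inr j) (f i)

/-- The system `f` multiplied by the adjugate of its matrix of partial derivatives. -/
def adjMul (f : τ → MvPolynomial (σ ⊕ τ) k) : τ → MvPolynomial (σ ⊕ τ) k :=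
  Matrix.mulVec (jac f).adjugate f

theorem sum_jac_mul_adjMul (f : τ → MvPolynomial (σ ⊕ τ) k) (i : τ) :
    ∑ j, jac f i j * adjMul f j = (jac f).det * f i := by
  have h : Matrix.mulVec (jac f) (adjMul f) = (jac f).det • f := by
    rw [adjMul, Matrix.mulVec_mulVec, Matrix.mul_adjugate, Matrix.smul_mulVec, Matrix.one_mulVec]
  exact congrFun h i

/-- By the product rule and `adj(J) * J = det J`, the Jacobian matrix of `adjMul f` in the variables
`τ` is `det J` times the identity up to multiples of the `f m`. A Newton step therefore divides by a
scalar instead of inverting a matrix. -/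
theorem pderiv_adjMul (f : τ → MvPolynomial (σ ⊕ τ) k) (i l : τ) :
    pderiv (Sum.inr l) (adjMul f i) = (if i = l then (jac f).det else 0) +
      ∑ m, pderiv (Sum.inr l) ((jac f).adjugate i m) * f m := by
  have h : ∑ m, (jac f).adjugate i m * jac f m l = if i = l then (jac f).det else 0 := by
    have := congrFun (congrFun (Matrix.adjugate_mul (jac f)) i) l
    rw [Matrix.mul_apply, Matrix.smul_apply, Matrix.one_apply] at this
    rw [this]
    split_ifs <;> simp
  rw [← h, ← Finset.sum_add_distrib, adjMul, Matrix.mulVec, dotProduct, map_sum]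
  refine Finset.sum_congr rfl fun m _ => ?_
  rw [Derivation.leibniz, smul_eq_mul, smul_eq_mul, mul_comm (f m)]
  rfl

variable {T : Type*} [CommRing T] [Algebra k T]

theorem adjMul_eq_zero (f : τ → MvPolynomial (σ ⊕ τ) k)
    {c : σ ⊕ τ → T} (h : ∀ j, aeval c (f j) = 0) (j : τ) : aeval c (adjMul f j) = 0 := by
  rw [adjMul, Matrix.mulVec, dotProduct, map_sum]
  exact Finset.sum_eq_zero fun i _ => by rw [map_mul, h, mul_zero]

/-- Multiplying `adjMul f` by the Jacobian matrix gives `det J * f = q * u * f`. Cancelling `q`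
recovers `f` from `adjMul f` at the cost of one power of `q`. -/
theorem aeval_mem_of_aeval_adjMul (f : τ → MvPolynomial (σ ⊕ τ) k) {c : σ ⊕ τ → T} {q u : T}
    {r : ℕ} {I : Ideal T} (hq : q ∈ nonZeroDivisors T) (hu : IsUnit u)
    (hdet : aeval c (jac f).det = q * u)
    (h : ∀ j, aeval c (adjMul f j) ∈ Ideal.span {q ^ (r + 1)} * I) (i : τ) :
    aeval c (f i) ∈ Ideal.span {q ^ r} * I := by
  have h1 : aeval c ((jac f).det * f i) ∈ Ideal.span {q ^ (r + 1)} * I := by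
    rw [← sum_jac_mul_adjMul, map_sum]
    refine Ideal.sum_mem _ fun j _ => ?_
    rw [map_mul]
    exact Ideal.mul_mem_left _ _ (h j)
  obtain ⟨z, hz, hz'⟩ := Ideal.mem_span_singleton_mul.1 h1
  rw [map_mul, hdet, mul_assoc, pow_succ', mul_assoc] at hz'
  have h2 := (mul_cancel_left_mem_nonZeroDivisors hq).1 hz'
  obtain ⟨v, rfl⟩ := hu
  have : aeval c (f i) = v⁻¹.1 * (q ^ r * z) := by rw [h2, Units.inv_mul_cancel_left]
  rw [this]
  exact Ideal.mul_mem_left _ _ (Ideal.mem_span_singleton_mul.2 ⟨z, hz, rfl⟩)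

variable [Fintype σ]

/-- Expansion of `adjMul f` in the direction of the variables indexed by `τ`. -/
theorem aeval_adjMul_sub_mem (f : τ → MvPolynomial (σ ⊕ τ) k) {c c' : σ ⊕ τ → T}
    (hl : ∀ i, c' (Sum.inl i) = c (Sum.inl i)) {I K : Ideal T}
    (hr : ∀ i, c' (Sum.inr i) - c (Sum.inr i) ∈ I) (hf : ∀ i, aeval c (f i) ∈ K) (j : τ) :
    aeval c' (adjMul f j) - aeval c (adjMul f j) -
      aeval c (jac f).det * (c' (Sum.inr j) - c (Sum.inr j)) ∈ I * K ⊔ I ^ 2 := by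
  have h1 := aeval_taylor_mem I (c := c) (c' := c')
    (by rintro (i | i); exacts [by simp [hl], hr i]) (adjMul f j)
  rw [Fintype.sum_sum_type] at h1
  simp only [hl, sub_self, mul_zero, Finset.sum_const_zero, zero_add, pderiv_adjMul, map_add,
    add_mul, Finset.sum_add_distrib] at h1
  have h2 : ∑ x, aeval c (if j = x then (jac f).det else 0) * (c' (Sum.inr x) - c (Sum.inr x)) =
      aeval c (jac f).det * (c' (Sum.inr j) - c (Sum.inr j)) := by
    rw [Finset.sum_eq_single j]
    · simp
    · intro b _ hb
      simp [Ne.symm hb]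
    · simp
  rw [h2] at h1
  have h3 : ∑ x, aeval c (∑ m, pderiv (Sum.inr x) ((jac f).adjugate j m) * f m) *
      (c' (Sum.inr x) - c (Sum.inr x)) ∈ I * K := by
    refine Ideal.sum_mem _ fun x _ => ?_
    rw [mul_comm I K, map_sum]
    refine Ideal.mul_mem_mul (Ideal.sum_mem _ fun m _ => ?_) (hr x)
    rw [map_mul]
    exact Ideal.mul_mem_left _ _ (hf m)
  convert Submodule.add_mem_sup h3 h1 using 1
  ring

/-- One step of Newton's method. -/
theorem aeval_adjMul_newton_step (f : τ → MvPolynomial (σ ⊕ τ) k) {c c' : σ ⊕ τ → T} {q u v : T}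
    {r : ℕ} (hr : 1 ≤ r) {I : Ideal T} (hq : q ∈ nonZeroDivisors T) (huv : u * v = 1)
    (hdet : aeval c (jac f).det = q * u) {a : τ → T} (ha : ∀ j, a j ∈ I)
    (h : ∀ j, aeval c (adjMul f j) = q ^ (r + 1) * a j)
    (hl : ∀ i, c' (Sum.inl i) = c (Sum.inl i))
    (hc : ∀ j, c' (Sum.inr j) = c (Sum.inr j) - q ^ r * (v * a j)) (j : τ) :
    aeval c' (adjMul f j) ∈ Ideal.span {q ^ (r + 1)} * I ^ 2 := by
  have hf := aeval_mem_of_aeval_adjMul f (r := r) (I := I) hq (IsUnit.of_mul_eq_one _ huv) hdet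
    fun j => Ideal.mem_span_singleton_mul.2 ⟨a j, ha j, (h j).symm⟩
  have h1 := aeval_adjMul_sub_mem f hl (I := Ideal.span {q ^ r} * I) (fun j => by
    rw [hc, sub_sub_cancel_left, neg_mem_iff]
    exact Ideal.mem_span_singleton_mul.2 ⟨_, Ideal.mul_mem_left _ _ (ha j), rfl⟩) hf j
  rw [← pow_two, sup_idem, mul_pow, Ideal.span_singleton_pow, ← pow_mul] at h1
  have h2 : aeval c' (adjMul f j) - aeval c (adjMul f j) -
      aeval c (jac f).det * (c' (Sum.inr j) - c (Sum.inr j)) = aeval c' (adjMul f j) := by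
    rw [h, hdet, hc]
    linear_combination (q ^ (r + 1) * a j) * huv
  rw [h2] at h1
  -- The linear terms cancel, and the quadratic error carries `q ^ (2 * r)`; since `r ≥ 1` this is a
  -- multiple of `q ^ (r + 1)`.
  refine Ideal.mul_mono_left ?_ h1
  rw [Ideal.span_singleton_le_span_singleton]
  exact pow_dvd_pow _ (by omega)

/-- Newton steps keep the error divisible by `q ^ (r + 1)` while the cofactor moves into ever higher
powers of the nilpotent ideal `I`, so finitely many steps kill it. Once `adjMul f` vanishes, so does
`f`, because `det J` is a non-zero-divisor. -/
theorem exists_newton (f : τ → MvPolynomial (σ ⊕ τ) k) (c : σ ⊕ τ → T) {q u : T}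
    {r : ℕ} (hr : 1 ≤ r) {I : Ideal T} (hI : IsNilpotent I) (hq : q ∈ nonZeroDivisors T)
    (hu : IsUnit u) (hdet : aeval c (jac f).det = q * u)
    (h : ∀ j, aeval c (adjMul f j) ∈ Ideal.span {q ^ (r + 1)} * I) :
    ∃ ζ : τ → T, (∀ j, ζ j ∈ I) ∧
      ∀ j, aeval (c + Sum.elim (fun _ => 0) (fun j => q ^ r * ζ j)) (f j) = 0 := by
  -- The determinant keeps the form `q` times a unit throughout the iteration: it changes by `q ^ r
  -- * n` with `n ∈ I`, so `u` changes by the nilpotent `q ^ (r - 1) * n`.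
  have hunit : ∀ ζ : τ → T, (∀ j, ζ j ∈ I) → ∃ u', IsUnit u' ∧
      aeval (c + Sum.elim (fun _ => 0) (fun j => q ^ r * ζ j)) (jac f).det = q * u' := by
    intro ζ hζ
    have h1 := aeval_sub_aeval_mem (Ideal.span {q ^ r} * I)
      (c := c) (c' := c + Sum.elim (fun _ => 0) (fun j => q ^ r * ζ j)) (by
        rintro (i | i)
        · simp
        · simpa using Ideal.mem_span_singleton_mul.2 ⟨_, hζ i, rfl⟩) (jac f).det
    obtain ⟨n, hn, hn'⟩ := Ideal.mem_span_singleton_mul.1 h1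
    refine ⟨u + q ^ (r - 1) * n, ?_, ?_⟩
    · refine IsNilpotent.isUnit_add_left_of_commute ?_ hu (Commute.all _ _)
      obtain ⟨m, hm⟩ := hI
      refine ⟨m, ?_⟩
      have := Ideal.pow_mem_pow (Ideal.mul_mem_left I (q ^ (r - 1)) hn) m
      rwa [hm] at this
    · obtain ⟨s, rfl⟩ := Nat.exists_eq_add_of_le' hr
      rw [← sub_add_cancel (aeval (c + Sum.elim (fun _ => 0) (fun j => q ^ (s + 1) * ζ j)) (jac f).det)
        (aeval c (jac f).det), ← hn', hdet, Nat.add_sub_cancel]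
      ring
  have key : ∀ m : ℕ, ∃ ζ : τ → T, (∀ j, ζ j ∈ I) ∧
      ∀ j, aeval (c + Sum.elim (fun _ => 0) (fun j => q ^ r * ζ j)) (adjMul f j) ∈
        Ideal.span {q ^ (r + 1)} * I ^ (m + 1) := by
    intro m
    induction m with
    | zero =>
      refine ⟨0, by simp, fun j => ?_⟩
      have : (c + Sum.elim (fun _ => 0) (fun j => q ^ r * (0 : τ → T) j)) = c := by
        funext i; cases i <;> simp
      rw [this]
      simpa using h j
    | succ m ih =>
      obtain ⟨ζ, hζ, hm⟩ := ih
      obtain ⟨u', hu', hdet'⟩ := hunit ζ hζ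
      obtain ⟨v, hv⟩ := hu'.exists_right_inv
      choose a ha ha' using fun j => Ideal.mem_span_singleton_mul.1 (hm j)
      refine ⟨fun j => ζ j - v * a j, fun j => Ideal.sub_mem _ (hζ j) (Ideal.mul_mem_left _ _
        (Ideal.pow_le_self (by omega) (ha j))), fun j => ?_⟩
      have := aeval_adjMul_newton_step f hr hq hv hdet' ha (fun j => (ha' j).symm)
        (c' := c + Sum.elim (fun _ => 0) (fun j => q ^ r * (ζ j - v * a j))) (by simp)
        (by intro j; simp only [Pi.add_apply, Sum.elim_inr]; ring) j
      rw [← pow_mul] at this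
      -- The step doubles the exponent of `I`; gaining one is enough.
      exact Ideal.mul_mono_right (Ideal.pow_le_pow_right (by omega)) this
  obtain ⟨m, hm⟩ := hI
  obtain ⟨ζ, hζ, h1⟩ := key m
  obtain ⟨u', hu', hdet'⟩ := hunit ζ hζ
  refine ⟨ζ, hζ, fun j => ?_⟩
  rw [pow_succ I m, hm, Ideal.zero_eq_bot, Ideal.bot_mul] at h1
  have := aeval_mem_of_aeval_adjMul f (r := r) (I := ⊥) hq hu' hdet' h1 j
  rwa [Ideal.mul_bot, Ideal.mem_bot] at this

/-- Expanding `adjMul f` between two zeros leaves only the linear term `q * u * q ^ r * ζ j` and a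
quadratic error in `q ^ (2 * r) * M ^ 2`, where `M` is the ideal generated by the `ζ j`. Cancelling
`q ^ (r + 1)` gives `M ≤ M ^ 2`, and `M` is nilpotent. -/
theorem eq_of_newton (f : τ → MvPolynomial (σ ⊕ τ) k) {c c' : σ ⊕ τ → T} {q u : T}
    {r : ℕ} (hr : 1 ≤ r) {I : Ideal T} (hI : IsNilpotent I) (hq : q ∈ nonZeroDivisors T)
    (hu : IsUnit u) (hdet : aeval c (jac f).det = q * u)
    (hl : ∀ i, c' (Sum.inl i) = c (Sum.inl i)) {ζ : τ → T} (hζ : ∀ j, ζ j ∈ I)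
    (hc : ∀ j, c' (Sum.inr j) - c (Sum.inr j) = q ^ r * ζ j)
    (h : ∀ j, aeval c (f j) = 0) (h' : ∀ j, aeval c' (f j) = 0) : ζ = 0 := by
  set M : Ideal T := Ideal.span (Set.range ζ)
  have hM : M ≤ I := Ideal.span_le.2 (by rintro _ ⟨j, rfl⟩; exact hζ j)
  have h1 : ∀ j, ζ j ∈ M ^ 2 := by
    intro j
    have h1 := aeval_adjMul_sub_mem f hl (I := Ideal.span {q ^ r} * M) (K := ⊥) (fun j =>
      Ideal.mem_span_singleton_mul.2 ⟨_, Ideal.subset_span ⟨j, rfl⟩, (hc j).symm⟩)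
      (fun i => h i) j
    rw [Ideal.mul_bot, bot_sup_eq, mul_pow, Ideal.span_singleton_pow, adjMul_eq_zero f h,
      adjMul_eq_zero f h', hdet, hc] at h1
    obtain ⟨z, hz, hz'⟩ := Ideal.mem_span_singleton_mul.1 h1
    obtain ⟨s, rfl⟩ := Nat.exists_eq_add_of_le' hr
    have h2 : q ^ (s + 2) * (q ^ s * z) = q ^ (s + 2) * (u * -ζ j) := by
      linear_combination hz'
    have h3 := (mul_cancel_left_mem_nonZeroDivisors (pow_mem hq _)).1 h2
    obtain ⟨v, rfl⟩ := hu
    have : ζ j = -(v⁻¹.1 * (q ^ s * z)) := by rw [h3, Units.inv_mul_cancel_left, neg_neg]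
    rw [this]
    exact neg_mem (Ideal.mul_mem_left _ _ (Ideal.mul_mem_left _ _ hz))
  have h2 : M ≤ M ^ 2 := Ideal.span_le.2 (by rintro _ ⟨j, rfl⟩; exact h1 j)
  have h3 : ∀ m : ℕ, M ≤ I ^ (m + 1) := by
    intro m
    induction m with
    | zero => simpa using hM
    | succ m ih =>
      refine h2.trans ?_
      rw [pow_two, pow_succ]
      exact Ideal.mul_mono ih hM
  obtain ⟨m, hm⟩ := hI
  funext j
  have := h3 m (Ideal.subset_span ⟨j, rfl⟩)
  rwa [pow_succ, hm, Ideal.zero_eq_bot, Ideal.bot_mul, Ideal.mem_bot] at this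

end Jacobian

end MvPolynomial


/-! ### Power series over a test ring and their reductions. -/

namespace TestRing

variable {k : Type u} [Field k] (A : TestRing k)

theorem reduction_eq_zero_iff (a : A) : A.reduction a = 0 ↔ a ∈ IsLocalRing.maximalIdeal A := by
  rw [← IsLocalRing.residue_eq_zero_iff]
  exact EmbeddingLike.map_eq_zero_iff (f := (AlgEquiv.ofBijective
    (Algebra.ofId k (IsLocalRing.ResidueField A)) A.bijective_residue).symm)

/-- The topology is discrete because a power of the maximal ideal vanishes: adic Cauchy sequences
are eventually constant. Completeness is what Weierstrass preparation and division require. -/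
instance isAdicComplete : IsAdicComplete (IsLocalRing.maximalIdeal A) A := by
  obtain ⟨m, hm⟩ := A.isNilpotent
  have hbot : (IsLocalRing.maximalIdeal A ^ m • ⊤ : Submodule A A) = ⊥ := by
    rw [hm, Ideal.zero_eq_bot, Submodule.bot_smul]
  refine { haus' := fun x hx => ?_, prec' := fun f hf => ⟨f m, fun n => ?_⟩ }
  · have := hx m
    rwa [hbot, SModEq.bot] at this
  · rcases le_total n m with h | h
    · exact hf h
    · have h1 := hf h
      rw [hbot, SModEq.bot] at h1
      rw [h1]

/-- Coefficientwise reduction of power series. -/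
def redSeries : A⟦X⟧ →ₐ[k] k⟦X⟧ := PowerSeries.mapAlgHom A.reduction

theorem coeff_redSeries (p : A⟦X⟧) (i : ℕ) :
    PowerSeries.coeff i (A.redSeries p) = A.reduction (PowerSeries.coeff i p) := by
  simp [redSeries, PowerSeries.mapAlgHom_apply]

theorem mem_ker_redSeries (p : A⟦X⟧) : p ∈ RingHom.ker A.redSeries ↔
    ∀ i, PowerSeries.coeff i p ∈ IsLocalRing.maximalIdeal A := by
  rw [RingHom.mem_ker, PowerSeries.ext_iff]
  simp [coeff_redSeries, reduction_eq_zero_iff]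

/-- The kernel consists of the series with all coefficients in the maximal ideal, and the
coefficients of its `m`-th power lie in the `m`-th power of that ideal. This is the nilpotent ideal
over which Newton's method runs. -/
theorem isNilpotent_ker_redSeries : IsNilpotent (RingHom.ker A.redSeries) := by
  have key : ∀ m : ℕ, ∀ p ∈ RingHom.ker A.redSeries ^ m, ∀ i,
      PowerSeries.coeff i p ∈ IsLocalRing.maximalIdeal A ^ m := by
    intro m
    induction m with
    | zero => simp
    | succ m ih =>
      intro p hp
      rw [pow_succ] at hp ⊢
      induction hp using Submodule.mul_induction_on' with
      | mem_mul_mem a ha b hb =>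
        exact PowerSeries.coeff_mul_mem_ideal_mul_ideal_of_coeff_mem_ideal' (ih a ha)
          ((A.mem_ker_redSeries b).1 hb)
      | add x _ y _ hx hy =>
        intro i
        rw [map_add]
        exact Ideal.add_mem _ (hx i) (hy i)
  obtain ⟨m, hm⟩ := A.isNilpotent
  refine ⟨m, ?_⟩
  rw [Ideal.zero_eq_bot, eq_bot_iff]
  intro p hp
  ext i
  have := key m p hp i
  rwa [hm] at this

theorem isUnit_of_isUnit_redSeries {p : A⟦X⟧} (h : IsUnit (A.redSeries p)) : IsUnit p := by
  rw [PowerSeries.isUnit_iff_constantCoeff] at h ⊢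
  rw [← PowerSeries.coeff_zero_eq_constantCoeff_apply, coeff_redSeries] at h
  rw [← PowerSeries.coeff_zero_eq_constantCoeff_apply, ← IsLocalRing.notMem_maximalIdeal,
    ← reduction_eq_zero_iff]
  exact h.ne_zero

theorem order_map_residue (p : A⟦X⟧) :
    (p.map (IsLocalRing.residue A)).order = (A.redSeries p).order := by
  have h : ∀ i, PowerSeries.coeff i (p.map (IsLocalRing.residue A)) = 0 ↔
      PowerSeries.coeff i (A.redSeries p) = 0 := by
    intro i
    rw [coeff_redSeries, reduction_eq_zero_iff, PowerSeries.coeff_map,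
      IsLocalRing.residue_eq_zero_iff]
  apply le_antisymm
  · exact PowerSeries.le_order _ _ fun i hi => (h i).1 (PowerSeries.coeff_of_lt_order i hi)
  · exact PowerSeries.le_order _ _ fun i hi => (h i).2 (PowerSeries.coeff_of_lt_order i hi)

theorem map_residue_ne_zero {p : A⟦X⟧} (h : A.redSeries p ≠ 0) :
    p.map (IsLocalRing.residue A) ≠ 0 := by
  rwa [Ne, ← PowerSeries.order_eq_top, order_map_residue, PowerSeries.order_eq_top]

/-- Such a `p` is a Weierstrass divisor, and an equation `p * x = 0` is a division of `0` with
remainder `0`, so uniqueness of the quotient forces `x = 0`. -/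
theorem mem_nonZeroDivisors_of_redSeries_ne_zero {p : A⟦X⟧} (h : A.redSeries p ≠ 0) :
    p ∈ nonZeroDivisors A⟦X⟧ := by
  rw [mem_nonZeroDivisors_iff_right]
  intro x hx
  have hd := PowerSeries.IsWeierstrassDivisor.of_map_ne_zero (A.map_residue_ne_zero h)
  refine (hd.eq_zero_of_mul_eq (r := 0) ?_ ?_).1
  · simp
  · rw [mul_comm, hx, Polynomial.coe_zero]

theorem redSeries_coe (p : A[X]) :
    A.redSeries (p : A⟦X⟧) = ((p.map A.reduction.toRingHom : k[X]) : k⟦X⟧) := by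
  ext i
  simp [coeff_redSeries]

end TestRing

/-! ### Weierstrass preparation and division over test rings. -/

namespace Polynomial

variable {R : Type*} [CommRing R] {q : R[X]} {d : ℕ}

theorem monic_of_sub_mem_degreeLT (h : q - X ^ d ∈ degreeLT R d) : q.Monic := by
  rw [mem_degreeLT] at h
  rw [← add_sub_cancel (X ^ d) q]
  exact monic_X_pow_add h

theorem natDegree_of_sub_mem_degreeLT [Nontrivial R] (h : q - X ^ d ∈ degreeLT R d) :
    q.natDegree = d := by
  rw [mem_degreeLT] at h
  rw [← add_sub_cancel (X ^ d) q, natDegree_eq_of_degree_eq_some]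
  rw [degree_add_eq_left_of_degree_lt (by rwa [degree_X_pow]), degree_X_pow]

theorem sub_mem_degreeLT_of_monic (h : q.Monic) (hd : q.natDegree = d) :
    q - X ^ d ∈ degreeLT R d := by
  nontriviality R
  rw [mem_degreeLT]
  have h1 : q.degree = d := by rw [degree_eq_natDegree h.ne_zero, hd]
  have := degree_sub_lt_left (p := q) (q := X ^ d) (by rw [degree_X_pow, h1]) h.ne_zero
    (by rw [h.leadingCoeff, (monic_X_pow d).leadingCoeff])
  rwa [h1] at this

end Polynomial

namespace TestRing

variable {k : Type u} [Field k] (A : TestRing k) {d : ℕ} {q : A[X]}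

theorem redSeries_coe_pow (hq' : q.map A.reduction.toRingHom = Polynomial.X ^ d) (m : ℕ) :
    A.redSeries ((q : A⟦X⟧) ^ m) = PowerSeries.X ^ (m * d) := by
  rw [map_pow, redSeries_coe, hq', Polynomial.coe_pow, Polynomial.coe_X, ← pow_mul, mul_comm]

theorem isDistinguishedAt (hq : q - Polynomial.X ^ d ∈ Polynomial.degreeLT A d)
    (hq' : q.map A.reduction.toRingHom = Polynomial.X ^ d) :
    q.IsDistinguishedAt (IsLocalRing.maximalIdeal A) := by
  refine ⟨⟨fun {n} hn => ?_⟩, Polynomial.monic_of_sub_mem_degreeLT hq⟩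
  rw [Polynomial.natDegree_of_sub_mem_degreeLT hq] at hn
  rw [← reduction_eq_zero_iff]
  have := congrArg (Polynomial.coeff · n) hq'
  simpa [Polynomial.coeff_map, Polynomial.coeff_X_pow, hn.ne] using this

theorem map_eq_of_isDistinguishedAt (hq : q.IsDistinguishedAt (IsLocalRing.maximalIdeal A))
    (hd : q.natDegree = d) : q.map A.reduction.toRingHom = Polynomial.X ^ d := by
  ext i
  rw [Polynomial.coeff_map, Polynomial.coeff_X_pow]
  rcases lt_trichotomy i d with h | h | h
  · rw [if_neg h.ne]
    exact (A.reduction_eq_zero_iff _).2 (hq.mem (hd ▸ h))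
  · subst hd
    rw [if_pos h, h, hq.monic.coeff_natDegree, map_one]
  · rw [if_neg h.ne', Polynomial.coeff_eq_zero_of_natDegree_lt (hd ▸ h), map_zero]

/-- Weierstrass preparation over a test ring. -/
theorem exists_weierstrass_factorization {g : A⟦X⟧} (hg : (A.redSeries g).order = d) :
    ∃ (q : A[X]) (v : A⟦X⟧), q - Polynomial.X ^ d ∈ Polynomial.degreeLT A d ∧
      q.map A.reduction.toRingHom = Polynomial.X ^ d ∧ IsUnit v ∧ g = q * v := by
  have hg0 : A.redSeries g ≠ 0 := by
    rw [Ne, ← PowerSeries.order_eq_top, hg]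
    exact ENat.natCast_ne_top d
  obtain ⟨q, v, h⟩ := PowerSeries.exists_isWeierstrassFactorization (A.map_residue_ne_zero hg0)
  have hd : q.natDegree = d := by
    rw [h.natDegree_eq_toNat_order_map, order_map_residue, hg, ENat.toNat_natCast]
  exact ⟨q, v, Polynomial.sub_mem_degreeLT_of_monic h.isDistinguishedAt.monic hd,
    A.map_eq_of_isDistinguishedAt h.isDistinguishedAt hd, h.isUnit, h.eq_mul⟩

theorem weierstrass_factorization_unique {q q' : A[X]} {v v' : A⟦X⟧}
    (hq : q - Polynomial.X ^ d ∈ Polynomial.degreeLT A d)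
    (hq' : q.map A.reduction.toRingHom = Polynomial.X ^ d)
    (h'q : q' - Polynomial.X ^ d ∈ Polynomial.degreeLT A d)
    (h'q' : q'.map A.reduction.toRingHom = Polynomial.X ^ d)
    (hv : IsUnit v) (hv' : IsUnit v') (h : (q : A⟦X⟧) * v = q' * v') : q = q' :=
  (PowerSeries.IsWeierstrassFactorization.elim (g := (q : A⟦X⟧) * v)
    ⟨A.isDistinguishedAt hq hq', hv, rfl⟩ ⟨A.isDistinguishedAt h'q h'q', hv', h⟩).1

theorem isWeierstrassDivisor_pow (hq' : q.map A.reduction.toRingHom = Polynomial.X ^ d) (m : ℕ) :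
    ((q : A⟦X⟧) ^ m).IsWeierstrassDivisor :=
  PowerSeries.IsWeierstrassDivisor.of_map_ne_zero (A.map_residue_ne_zero (by
    rw [A.redSeries_coe_pow hq']
    exact pow_ne_zero _ PowerSeries.X_ne_zero))

theorem degree_lt_order_iff (hq' : q.map A.reduction.toRingHom = Polynomial.X ^ d) (m : ℕ)
    (z : A[X]) :
    z.degree < (((q : A⟦X⟧) ^ m).map (IsLocalRing.residue A)).order.toNat ↔
      z ∈ Polynomial.degreeLT A (m * d) := by
  rw [order_map_residue, A.redSeries_coe_pow hq', PowerSeries.order_X_pow, ENat.toNat_natCast,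
    Polynomial.mem_degreeLT]

/-- Weierstrass division by powers of a distinguished polynomial over a test ring. -/
theorem exists_weierstrass_division (hq' : q.map A.reduction.toRingHom = Polynomial.X ^ d) (m : ℕ)
    (c : A⟦X⟧) : ∃ (w : A⟦X⟧) (z : A[X]), z ∈ Polynomial.degreeLT A (m * d) ∧
      c = z + (q : A⟦X⟧) ^ m * w := by
  have h := (A.isWeierstrassDivisor_pow hq' m).isWeierstrassDivisionAt_div_mod c
  exact ⟨_, _, (A.degree_lt_order_iff hq' m _).1 h.degree_lt, h.eq_mul_add.trans (add_comm _ _)⟩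

theorem weierstrass_division_unique (hq' : q.map A.reduction.toRingHom = Polynomial.X ^ d) {m : ℕ}
    {w w' : A⟦X⟧} {z z' : A[X]} (hz : z ∈ Polynomial.degreeLT A (m * d))
    (hz' : z' ∈ Polynomial.degreeLT A (m * d))
    (h : (z : A⟦X⟧) + (q : A⟦X⟧) ^ m * w = z' + (q : A⟦X⟧) ^ m * w') : w = w' ∧ z = z' :=
  (A.isWeierstrassDivisor_pow hq' m).eq_of_mul_add_eq_mul_add
    ((A.degree_lt_order_iff hq' m _).2 hz) ((A.degree_lt_order_iff hq' m _).2 hz')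
    (by rw [add_comm, h, add_comm])

/-- Euclidean division of a polynomial by the monic `q ^ m` is also its Weierstrass division, so by
uniqueness the two remainders vanish together. This turns divisibility along arcs into divisibility
of polynomials, which is a condition of finite type. -/
theorem coe_dvd_coe_iff (hq : q - Polynomial.X ^ d ∈ Polynomial.degreeLT A d)
    (hq' : q.map A.reduction.toRingHom = Polynomial.X ^ d) (m : ℕ) (p : A[X]) :
    (q : A⟦X⟧) ^ m ∣ (p : A⟦X⟧) ↔ q ^ m ∣ p := by
  constructor
  · rintro ⟨w, hw⟩
    have hmon : (q ^ m).Monic := (Polynomial.monic_of_sub_mem_degreeLT hq).pow m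
    have h1 : ((p %ₘ q ^ m : A[X]) : A⟦X⟧) + (q : A⟦X⟧) ^ m * ((p /ₘ q ^ m : A[X]) : A⟦X⟧) =
        ((0 : A[X]) : A⟦X⟧) + (q : A⟦X⟧) ^ m * w := by
      rw [← hw, Polynomial.coe_zero, zero_add, ← Polynomial.coe_pow, ← Polynomial.coe_mul,
        ← Polynomial.coe_add, Polynomial.modByMonic_add_div]
    rw [← Polynomial.modByMonic_eq_zero_iff_dvd hmon]
    refine (A.weierstrass_division_unique hq' ?_ (Submodule.zero_mem _) h1).2
    rw [Polynomial.mem_degreeLT]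
    refine (Polynomial.degree_modByMonic_lt _ hmon).trans_le ?_
    rw [Polynomial.degree_eq_natDegree hmon.ne_zero,
      (Polynomial.monic_of_sub_mem_degreeLT hq).natDegree_pow,
      Polynomial.natDegree_of_sub_mem_degreeLT hq]
  · rintro ⟨w, rfl⟩
    rw [Polynomial.coe_mul, Polynomial.coe_pow]
    exact Dvd.intro _ rfl

theorem coe_mem_nonZeroDivisors (hq' : q.map A.reduction.toRingHom = Polynomial.X ^ d) :
    (q : A⟦X⟧) ∈ nonZeroDivisors A⟦X⟧ := by
  refine A.mem_nonZeroDivisors_of_redSeries_ne_zero ?_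
  have := A.redSeries_coe_pow hq' 1
  rw [pow_one] at this
  rw [this]
  exact pow_ne_zero _ PowerSeries.X_ne_zero

end TestRing


/-! ### Functors on test rings and systems of congruences. -/

section Functors

variable {k : Type u} [Field k]

/-- A functor to types given by plain functions. -/
def TestRing.typeFunctor (F : TestRing k → Type u)
    (m : ∀ {A B : TestRing k}, (A →ₐ[k] B) → F A → F B)
    (h₁ : ∀ (A : TestRing k) (x : F A), m (AlgHom.id k A) x = x)
    (h₂ : ∀ (A B C : TestRing k) (f : A →ₐ[k] B) (g : B →ₐ[k] C) (x : F A),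
      m (g.comp f) x = m g (m f x)) : TestRing k ⥤ Type u where
  obj := F
  map f := TypeCat.ofHom (m (TestRing.algHom f))
  map_id A := TypeCat.homEquiv.injective (funext fun x => h₁ A x)
  map_comp _ _ := TypeCat.homEquiv.injective (funext fun x => h₂ _ _ _ _ _ x)

theorem nonempty_iso_of_bijective {C : Type*} [Category C] {F G : C ⥤ Type u}
    (η : ∀ A, F.obj A → G.obj A)
    (nat : ∀ (A B : C) (f : A ⟶ B) (x : F.obj A), η B (F.map f x) = G.map f (η A x))
    (bij : ∀ A, Function.Bijective (η A)) : Nonempty (F ≅ G) :=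
  ⟨NatIso.ofComponents (fun A => (Equiv.ofBijective (η A) (bij A)).toIso) fun {A B} f =>
    TypeCat.homEquiv.injective (funext fun x => nat A B f x)⟩

theorem nonempty_prod_iso {C : Type*} [Category C] {F F' : C ⥤ Type u} (α : F ≅ F')
    (G : C ⥤ Type u) :
    Nonempty (FunctorToTypes.prod F G ≅ FunctorToTypes.prod F' G) := by
  refine nonempty_iso_of_bijective (fun A x => (α.hom.app A x.1, x.2)) ?_ ?_
  · intro A B f x
    exact Prod.ext (NatTrans.naturality_apply α.hom f x.1) rfl
  · intro A
    exact ((α.app A).toEquiv.prodCongr (Equiv.refl _)).bijective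

end Functors

/-- Solutions of a system of congruences modulo powers of a monic polynomial: `q` is monic of
degree `d`, the `z i` are polynomials of degree `< D i`, and `q ^ e l` divides `P l (z)`. -/
@[ext]
structure CongSol {k : Type u} [Field k] {ι Λ : Type} (P : Λ → MvPolynomial ι k) (e : Λ → ℕ)
    (D : ι → ℕ) (d : ℕ) (R : Type u) [CommRing R] [Algebra k R] where
  q : R[X]
  z : ι → R[X]
  q_mem : q - Polynomial.X ^ d ∈ Polynomial.degreeLT R d
  z_mem : ∀ i, z i ∈ Polynomial.degreeLT R (D i)
  dvd : ∀ l, q ^ e l ∣ MvPolynomial.aeval z (P l)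

section CongSol

variable {k : Type u} [Field k] {ι Λ : Type} {P : Λ → MvPolynomial ι k} {e : Λ → ℕ}
  {D : ι → ℕ} {d : ℕ} {R S T : Type u} [CommRing R] [Algebra k R] [CommRing S] [Algebra k S]
  [CommRing T] [Algebra k T]

theorem Polynomial.map_aeval_mvPolynomial (φ : R →ₐ[k] S) (z : ι → R[X]) (p : MvPolynomial ι k) :
    (MvPolynomial.aeval z p).map φ.toRingHom =
      MvPolynomial.aeval (fun i => (z i).map φ.toRingHom) p :=
  MvPolynomial.comp_aeval_apply z (Polynomial.mapAlgHom φ) p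

namespace CongSol

/-- Base change of solutions of congruences. -/
def map (φ : R →ₐ[k] S) (τ : CongSol P e D d R) : CongSol P e D d S where
  q := τ.q.map φ.toRingHom
  z i := (τ.z i).map φ.toRingHom
  q_mem := by simpa using map_mem_degreeLT φ.toRingHom τ.q_mem
  z_mem i := map_mem_degreeLT φ.toRingHom (τ.z_mem i)
  dvd l := by
    rw [← Polynomial.map_aeval_mvPolynomial, ← Polynomial.map_pow]
    exact Polynomial.map_dvd _ (τ.dvd l)

theorem map_id (τ : CongSol P e D d R) : τ.map (AlgHom.id k R) = τ := by
  ext i <;> simp [map]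

theorem map_comp (φ : R →ₐ[k] S) (ψ : S →ₐ[k] T) (τ : CongSol P e D d R) :
    τ.map (ψ.comp φ) = (τ.map φ).map ψ := by
  ext i <;> simp [map]

/-- The functor of solutions over test rings with a given reduction. -/
def nbhd (τ₀ : CongSol P e D d k) : TestRing k ⥤ Type u :=
  TestRing.typeFunctor (fun A => { τ : CongSol P e D d A // τ.map A.reduction = τ₀ })
    (fun {A B} f τ => ⟨τ.1.map f, by
      rw [← map_comp, A.eq_reduction (B.reduction.comp f)]
      exact τ.2⟩)
    (fun A τ => Subtype.ext τ.1.map_id) (fun A B C f g τ => Subtype.ext (τ.1.map_comp f g))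

end CongSol

end CongSol


/-! ### Points of formal discs and free power series. -/

section FormalDisc

variable {k : Type u} [Field k]

theorem formalDisc_apply {A : Type u} [CommRing A] [Algebra k A] (φ : k⟦X⟧ →ₐ[k] A) {N : ℕ}
    (hN : φ (PowerSeries.X ^ N) = 0) (p : k⟦X⟧) :
    φ p = Polynomial.aeval (φ PowerSeries.X) (PowerSeries.trunc N p) := by
  conv_lhs => rw [PowerSeries.eq_X_pow_mul_shift_add_trunc N p]
  rw [map_add, map_mul, hN, zero_mul, zero_add]
  have : φ.comp (Polynomial.coeToPowerSeries.algHom k) = Polynomial.aeval (φ PowerSeries.X) := by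
    ext
    simp [Polynomial.coeToPowerSeries.algHom_apply]
  rw [← this]
  simp [Polynomial.coeToPowerSeries.algHom_apply]

theorem formalDisc_ext {A : Type u} [CommRing A] [Algebra k A] {φ ψ : k⟦X⟧ →ₐ[k] A}
    (hφ : ∃ N : ℕ, φ (PowerSeries.X ^ N) = 0) (hψ : ∃ N : ℕ, ψ (PowerSeries.X ^ N) = 0)
    (h : φ PowerSeries.X = ψ PowerSeries.X) : φ = ψ := by
  obtain ⟨N, hN⟩ := hφ
  obtain ⟨M, hM⟩ := hψ
  have h1 : φ (PowerSeries.X ^ (N + M)) = 0 := by rw [pow_add, map_mul, hN, zero_mul]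
  have h2 : ψ (PowerSeries.X ^ (N + M)) = 0 := by rw [pow_add, map_mul, hM, mul_zero]
  ext p
  rw [formalDisc_apply φ h1, formalDisc_apply ψ h2, h]

theorem Polynomial.aeval_eq_zero_of_coeff {A : Type u} [CommRing A] [Algebra k A] {a : A} {N : ℕ}
    (ha : a ^ N = 0) (p : k[X]) (hp : ∀ i < N, p.coeff i = 0) : aeval a p = 0 := by
  obtain ⟨s, rfl⟩ := X_pow_dvd_iff.2 hp
  rw [map_mul, map_pow, aeval_X, ha, zero_mul]

/-- If `a ^ N = 0`, evaluating the truncation below degree `N` at `a` is multiplicative, because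
truncating a product only discards terms killed by `a ^ N`. -/
theorem exists_formalDisc {A : Type u} [CommRing A] [Algebra k A] {a : A} (ha : IsNilpotent a) :
    ∃ φ : k⟦X⟧ →ₐ[k] A, (∃ N : ℕ, φ (PowerSeries.X ^ N) = 0) ∧ φ PowerSeries.X = a := by
  obtain ⟨N₀, hN₀⟩ := ha
  -- The bound `2 ≤ N` ensures that truncation fixes both `1` and the variable.
  obtain ⟨N, hN, hN2⟩ : ∃ N : ℕ, a ^ N = 0 ∧ 2 ≤ N :=
    ⟨N₀ + 2, by rw [pow_add, hN₀, zero_mul], by omega⟩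
  refine ⟨AlgHom.ofLinearMap
    { toFun := fun p => Polynomial.aeval a (PowerSeries.trunc N p)
      map_add' := fun p q => by simp
      map_smul' := fun c p => by
        rw [RingHom.id_apply, ← map_smul]
        congr 1
        ext i
        simp [PowerSeries.coeff_trunc] } ?_ ?_, ⟨N, ?_⟩, ?_⟩
  · change Polynomial.aeval a (PowerSeries.trunc N 1) = 1
    obtain ⟨M, rfl⟩ := Nat.exists_eq_add_of_le' hN2
    rw [PowerSeries.trunc_one, map_one]
  · intro p q
    change Polynomial.aeval a (PowerSeries.trunc N (p * q)) =
      Polynomial.aeval a (PowerSeries.trunc N p) * Polynomial.aeval a (PowerSeries.trunc N q)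
    rw [← map_mul, ← sub_eq_zero, ← map_sub]
    refine Polynomial.aeval_eq_zero_of_coeff hN _ fun i hi => ?_
    rw [Polynomial.coeff_sub, PowerSeries.coeff_trunc, if_pos hi, sub_eq_zero,
      PowerSeries.coeff_mul, Polynomial.coeff_mul]
    refine Finset.sum_congr rfl fun x hx => ?_
    have := Finset.HasAntidiagonal.mem_antidiagonal.1 hx
    rw [PowerSeries.coeff_trunc, PowerSeries.coeff_trunc, if_pos (by omega), if_pos (by omega)]
  · change Polynomial.aeval a (PowerSeries.trunc N (PowerSeries.X ^ N)) = 0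
    refine Polynomial.aeval_eq_zero_of_coeff hN _ fun i hi => ?_
    rw [PowerSeries.coeff_trunc, if_pos hi, PowerSeries.coeff_X_pow, if_neg hi.ne]
  · change Polynomial.aeval a (PowerSeries.trunc N PowerSeries.X) = a
    obtain ⟨M, rfl⟩ := Nat.exists_eq_add_of_le' hN2
    rw [PowerSeries.trunc_X, Polynomial.aeval_X]

end FormalDisc

namespace TestRing

variable {k : Type u} [Field k]

theorem isNilpotent_of_mem (A : TestRing k) {a : A} (ha : a ∈ IsLocalRing.maximalIdeal A) :
    IsNilpotent a := by
  obtain ⟨m, hm⟩ := A.isNilpotent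
  refine ⟨m, ?_⟩
  have := Ideal.pow_mem_pow ha m
  rwa [hm] at this

theorem mem_of_isNilpotent (A : TestRing k) {a : A} (ha : IsNilpotent a) :
    a ∈ IsLocalRing.maximalIdeal A := by
  rw [← reduction_eq_zero_iff]
  exact (ha.map A.reduction).eq_zero

theorem redSeries_mapAlgHom {A B : TestRing k} (f : A →ₐ[k] B) (p : A⟦X⟧) :
    B.redSeries (PowerSeries.mapAlgHom f p) = A.redSeries p := by
  rw [redSeries, redSeries, ← A.eq_reduction (B.reduction.comp f), mapAlgHom_comp]
  rfl

/-- The constant lift of a power series over `k`. -/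
def liftSeries (A : TestRing k) : k⟦X⟧ →ₐ[k] A⟦X⟧ := PowerSeries.mapAlgHom (Algebra.ofId k A)

theorem redSeries_liftSeries (A : TestRing k) (p : k⟦X⟧) : A.redSeries (A.liftSeries p) = p := by
  rw [redSeries, liftSeries]
  change ((PowerSeries.mapAlgHom A.reduction).comp
    (PowerSeries.mapAlgHom (Algebra.ofId k A))) p = p
  rw [← mapAlgHom_comp, Subsingleton.elim (A.reduction.comp (Algebra.ofId k A)) (AlgHom.id k k),
    mapAlgHom_id, AlgHom.id_apply]

theorem mapAlgHom_liftSeries {A B : TestRing k} (f : A →ₐ[k] B) (p : k⟦X⟧) :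
    PowerSeries.mapAlgHom f (A.liftSeries p) = B.liftSeries p := by
  change ((PowerSeries.mapAlgHom f).comp (PowerSeries.mapAlgHom (Algebra.ofId k A))) p = _
  rw [← mapAlgHom_comp, Subsingleton.elim (f.comp (Algebra.ofId k A)) (Algebra.ofId k B)]
  rfl

/-- Families of power series with prescribed reductions. -/
def seriesNbhd {σ : Type} (w₀ : σ → k⟦X⟧) : TestRing k ⥤ Type u :=
  typeFunctor (fun A => { w : σ → A⟦X⟧ // ∀ i, A.redSeries (w i) = w₀ i })
    (fun f w => ⟨fun i => PowerSeries.mapAlgHom f (w.1 i), fun i => by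
      rw [redSeries_mapAlgHom, w.2]⟩)
    (fun A w => Subtype.ext (funext fun i => by
      change PowerSeries.mapAlgHom (AlgHom.id k A) (w.1 i) = _
      rw [mapAlgHom_id, AlgHom.id_apply]))
    (fun A B C f g w => Subtype.ext (funext fun i => by
      change PowerSeries.mapAlgHom (g.comp f) (w.1 i) = _
      rw [mapAlgHom_comp]
      rfl))

/-- A point of the disc is an element of the maximal ideal, namely the image of the variable. The
coefficients of the differences between `w` and the constant lift of `w₀` form a family of such
elements indexed by `σ × ℕ`, which is in bijection with `ℕ` because `σ` is nonempty. -/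
theorem nonempty_formalDiscPow_iso_seriesNbhd {σ : Type} [Finite σ] [Nonempty σ]
    (w₀ : σ → k⟦X⟧) : Nonempty (formalDiscPow k ≅ seriesNbhd w₀) := by
  obtain ⟨ε⟩ : Nonempty (σ × ℕ ≃ ℕ) := nonempty_equiv_of_countable
  have hmem : ∀ (A : TestRing k) (φ : (formalDiscPow k).obj A) (j : ℕ),
      (φ j).1 PowerSeries.X ∈ IsLocalRing.maximalIdeal A := by
    intro A φ j
    obtain ⟨N, hN⟩ := (φ j).2
    exact A.mem_of_isNilpotent ⟨N, by rw [← map_pow, hN]⟩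
  refine nonempty_iso_of_bijective (fun A φ => ⟨fun i => A.liftSeries (w₀ i) +
    PowerSeries.mk fun n => (φ (ε (i, n))).1 PowerSeries.X, fun i => ?_⟩) ?_ ?_
  · rw [map_add, redSeries_liftSeries, add_eq_left, ← RingHom.mem_ker, mem_ker_redSeries]
    intro n
    rw [PowerSeries.coeff_mk]
    exact hmem A φ _
  · intro A B f φ
    refine Subtype.ext (funext fun i => ?_)
    change _ = PowerSeries.mapAlgHom (algHom f) (A.liftSeries (w₀ i) +
      PowerSeries.mk fun n => (φ (ε (i, n))).1 PowerSeries.X)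
    rw [map_add, mapAlgHom_liftSeries]
    congr 1
  · intro A
    constructor
    · intro φ ψ h
      refine funext fun j => Subtype.ext (formalDisc_ext (φ j).2 (ψ j).2 ?_)
      obtain ⟨⟨i, n⟩, rfl⟩ := ε.surjective j
      have := congrArg (PowerSeries.coeff n) (add_left_cancel (congrFun (Subtype.ext_iff.1 h) i))
      simpa using this
    · intro w
      have h : ∀ j : ℕ, ∃ φ : k⟦X⟧ →ₐ[k] A, (∃ N : ℕ, φ (PowerSeries.X ^ N) = 0) ∧
          φ PowerSeries.X = PowerSeries.coeff (ε.symm j).2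
            (w.1 (ε.symm j).1 - A.liftSeries (w₀ (ε.symm j).1)) := by
        intro j
        refine exists_formalDisc (A.isNilpotent_of_mem ((A.mem_ker_redSeries _).1 ?_ _))
        rw [RingHom.mem_ker, map_sub, redSeries_liftSeries, w.2, sub_self]
      choose φ hφ hφ' using h
      refine ⟨fun j => ⟨φ j, hφ j⟩, Subtype.ext (funext fun i => ?_)⟩
      change A.liftSeries (w₀ i) + PowerSeries.mk (fun n => φ (ε (i, n)) PowerSeries.X) = w.1 i
      simp only [hφ', Equiv.symm_apply_apply]
      rw [← eq_sub_iff_add_eq']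
      ext n
      rw [PowerSeries.coeff_mk]

end TestRing


/-! ### The congruences modulo powers of `q` that make Newton's method work. -/

namespace MvPolynomial

section

variable {σ τ : Type} [Fintype τ] [DecidableEq τ] {k : Type u} [Field k]

/-- The polynomials whose divisibility by powers of `q` makes Newton's method for `f` work: the
Jacobian determinant, the system `f`, and `f` multiplied by the adjugate. -/
def newtonSystem (f : τ → MvPolynomial (σ ⊕ τ) k) : Option (τ ⊕ τ) → MvPolynomial (σ ⊕ τ) k
  | none => (jac f).det
  | some (Sum.inl j) => f j
  | some (Sum.inr j) => adjMul f j

/-- The exponents of `q` belonging to `newtonSystem`. -/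
def newtonExp (r : ℕ) : Option (τ ⊕ τ) → ℕ
  | none => 1
  | some (Sum.inl _) => 1
  | some (Sum.inr _) => r + 1

/-- The precision to which the variables are truncated. -/
def newtonPrec (r : ℕ) : σ ⊕ τ → ℕ := Sum.elim (fun _ => r + 1) fun _ => r

theorem newtonSystem_dvd_of_eq_zero {T : Type*} [CommRing T] [Algebra k T]
    (f : τ → MvPolynomial (σ ⊕ τ) k) {c : σ ⊕ τ → T} {q : T} (r : ℕ)
    (h : ∀ j, aeval c (f j) = 0) (hdet : q ∣ aeval c (jac f).det) (l : Option (τ ⊕ τ)) :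
    q ^ newtonExp r l ∣ aeval c (newtonSystem f l) := by
  match l with
  | none => simpa [newtonExp, newtonSystem] using hdet
  | some (Sum.inl j) => simp [newtonSystem, h]
  | some (Sum.inr j) => simp [newtonSystem, adjMul_eq_zero f h]

/-- This explains the choice of precisions: the congruences depend on `x` only modulo `q ^ (r + 1)`
and on `y` only modulo `q ^ r`, so they pass between an arc and its remainders. The coarser
precision for `y` is harmless because both `det J` and `f` are divisible by `q`, which supplies the
missing factor in the expansion of `adjMul f`. -/
theorem newtonSystem_dvd_of_congr [Fintype σ] {T : Type*} [CommRing T] [Algebra k T]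
    (f : τ → MvPolynomial (σ ⊕ τ) k) {c c' : σ ⊕ τ → T} {q : T} {r : ℕ} (hr : 1 ≤ r)
    (h : ∀ i, q ^ newtonPrec r i ∣ c' i - c i)
    (hc : ∀ l, q ^ newtonExp r l ∣ aeval c (newtonSystem f l)) (l : Option (τ ⊕ τ)) :
    q ^ newtonExp r l ∣ aeval c' (newtonSystem f l) := by
  -- The change is made in two stages: first only the variables `σ`, where plain congruence modulo
  -- `q ^ (r + 1)` suffices, then the variables `τ`.
  set c₁ : σ ⊕ τ → T := Sum.elim (fun i => c' (Sum.inl i)) fun i => c (Sum.inr i) with hc₁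
  have h1 : ∀ l, q ^ newtonExp r l ∣ aeval c₁ (newtonSystem f l) := by
    intro l
    have h2 := aeval_sub_aeval_mem (Ideal.span {q ^ (r + 1)}) (c := c) (c' := c₁) (by
      rintro (i | i)
      · exact Ideal.mem_span_singleton.2 (h (Sum.inl i))
      · simp [hc₁]) (newtonSystem f l)
    rw [Ideal.mem_span_singleton] at h2
    have h3 : newtonExp r l ≤ r + 1 := by
      match l with
      | none => simp [newtonExp]
      | some (Sum.inl j) => simp [newtonExp]
      | some (Sum.inr j) => simp [newtonExp]
    exact (dvd_iff_dvd_of_dvd_sub ((pow_dvd_pow q h3).trans h2)).2 (hc l)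
  have h4 : ∀ P : MvPolynomial (σ ⊕ τ) k, q ∣ aeval c₁ P → q ∣ aeval c' P := by
    intro P hP
    have h2 := aeval_sub_aeval_mem (Ideal.span {q}) (c := c₁) (c' := c') (by
      rintro (i | i)
      · simp [hc₁]
      · rw [Ideal.mem_span_singleton]
        exact (dvd_pow_self q (show r ≠ 0 by omega)).trans (h (Sum.inr i))) P
    rw [Ideal.mem_span_singleton] at h2
    exact (dvd_iff_dvd_of_dvd_sub h2).2 hP
  match l with
  | none =>
    simpa [newtonExp] using h4 _ (by simpa [newtonExp] using h1 none)
  | some (Sum.inl j) =>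
    simpa [newtonExp] using h4 _ (by simpa [newtonExp] using h1 (some (Sum.inl j)))
  | some (Sum.inr j) =>
    have h2 := aeval_adjMul_sub_mem f (c := c₁) (c' := c') (by simp [hc₁])
      (I := Ideal.span {q ^ r}) (K := Ideal.span {q})
      (fun i => Ideal.mem_span_singleton.2 (h (Sum.inr i)))
      (fun i => Ideal.mem_span_singleton.2 (by
        simpa [newtonExp, newtonSystem] using h1 (some (Sum.inl i)))) j
    -- Both error terms are multiples of `q ^ (r + 1)`: the first contains a value of `f`, the
    -- second is quadratic in the displacement and `2 * r ≥ r + 1`.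
    have h3 : Ideal.span {q ^ r} * Ideal.span {q} ⊔ Ideal.span {q ^ r} ^ 2 ≤
        Ideal.span {q ^ (r + 1)} := by
      rw [Ideal.span_singleton_mul_span_singleton, Ideal.span_singleton_pow, ← pow_succ, ← pow_mul]
      exact sup_le le_rfl ((Ideal.span_singleton_le_span_singleton).2
        (pow_dvd_pow _ (by omega)))
    have h5 := Ideal.mem_span_singleton.1 (h3 h2)
    have h6 : q ^ (r + 1) ∣ aeval c₁ (jac f).det * (c' (Sum.inr j) - c₁ (Sum.inr j)) := by
      rw [pow_succ']
      exact mul_dvd_mul (by simpa [newtonExp, newtonSystem] using h1 none) (h (Sum.inr j))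
    have h7 := (dvd_sub_left h6).1 h5
    exact (dvd_iff_dvd_of_dvd_sub h7).2 (h1 (some (Sum.inr j)))

end

end MvPolynomial

/-- The solutions in power series over test rings, with a given reduction, of a system of
polynomial equations. -/
def arcPoints {k : Type u} [Field k] {ι : Type} {J : Type*} (f : J → MvPolynomial ι k)
    (c₀ : ι → k⟦X⟧) : TestRing k ⥤ Type u :=
  TestRing.typeFunctor (fun A => { c : ι → A⟦X⟧ // (∀ j, MvPolynomial.aeval c (f j) = 0) ∧
      ∀ i, A.redSeries (c i) = c₀ i })
    (fun φ c => ⟨fun i => PowerSeries.mapAlgHom φ (c.1 i), fun j => by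
      have h := MvPolynomial.comp_aeval_apply c.1 (PowerSeries.mapAlgHom φ) (f j)
      rw [c.2.1, map_zero] at h
      exact h.symm, fun i => by rw [TestRing.redSeries_mapAlgHom, c.2.2]⟩)
    (fun A c => Subtype.ext (funext fun i => by
      change PowerSeries.mapAlgHom (AlgHom.id k A) (c.1 i) = _
      rw [mapAlgHom_id, AlgHom.id_apply]))
    (fun A B C φ ψ c => Subtype.ext (funext fun i => by
      change PowerSeries.mapAlgHom (ψ.comp φ) (c.1 i) = _
      rw [mapAlgHom_comp]
      rfl))


namespace MvPolynomial

variable {k : Type u} [Field k]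

theorem aeval_coe_powerSeries {ι : Type} {A : Type u} [CommRing A] [Algebra k A] (z : ι → A[X])
    (p : MvPolynomial ι k) :
    aeval (fun i => (z i : A⟦X⟧)) p = ((aeval z p : A[X]) : A⟦X⟧) :=
  (comp_aeval_apply z ((Polynomial.coeToPowerSeries.algHom (R := A) A).restrictScalars k) p).symm

section

variable {σ τ : Type} [Fintype σ] [Fintype τ] [DecidableEq τ]

/-- This is the base point of `Y`. The arc itself satisfies the congruences with `q = t^d`, since
`f` vanishes on it and the determinant has order `d`; truncation stays within the permitted
precision. -/
theorem exists_congSol (f : τ → MvPolynomial (σ ⊕ τ) k) {c₀ : σ ⊕ τ → k⟦X⟧} {d r : ℕ}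
    (hr : 1 ≤ r) (hf : ∀ j, aeval c₀ (f j) = 0) (hd : (aeval c₀ (jac f).det).order = d) :
    ∃ S₀ : CongSol (newtonSystem f) (newtonExp r) (fun i => newtonPrec r i * d) d k,
      S₀.q = Polynomial.X ^ d ∧
        ∀ i, S₀.z i = PowerSeries.trunc (newtonPrec r i * d) (c₀ i) := by
  refine ⟨⟨Polynomial.X ^ d, fun i => PowerSeries.trunc (newtonPrec r i * d) (c₀ i), ?_, fun i => ?_,
    fun l => ?_⟩, rfl, fun _ => rfl⟩
  · simp
  · rw [Polynomial.mem_degreeLT]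
    exact PowerSeries.degree_trunc_lt _ _
  · have h1 := newtonSystem_dvd_of_eq_zero f (q := PowerSeries.X ^ d) r hf
      (by rw [PowerSeries.X_pow_dvd_iff]
          intro m hm
          exact PowerSeries.coeff_of_lt_order m (by rw [hd]; exact_mod_cast hm))
    have h2 := newtonSystem_dvd_of_congr f hr (c' := fun i =>
      ((PowerSeries.trunc (newtonPrec r i * d) (c₀ i) : k[X]) : k⟦X⟧)) (fun i => by
        rw [← pow_mul, mul_comm d, PowerSeries.X_pow_dvd_iff]
        intro m hm
        rw [map_sub, Polynomial.coeff_coe, PowerSeries.coeff_trunc, if_pos hm, sub_self]) h1 l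
    rw [aeval_coe_powerSeries, ← pow_mul, PowerSeries.X_pow_dvd_iff] at h2
    rw [← pow_mul, Polynomial.X_pow_dvd_iff]
    simpa using h2

end

end MvPolynomial

/-! ### Arcs as remainders and quotients; the isomorphism with a product. -/

namespace CongSol

variable {k : Type u} [Field k] {ι Λ : Type} {P : Λ → MvPolynomial ι k} {e : Λ → ℕ}
  {D : ι → ℕ} {d : ℕ}

theorem mapAlgHom_coe {A B : Type u} [CommRing A] [Algebra k A] [CommRing B] [Algebra k B]
    (φ : A →ₐ[k] B) (p : A[X]) : PowerSeries.mapAlgHom φ (p : A⟦X⟧) =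
      ((p.map φ.toRingHom : B[X]) : B⟦X⟧) := by
  ext i
  simp [PowerSeries.mapAlgHom_apply]

/-- The vector of power series with remainders `S.z` and quotients `w` with respect to division by
powers of `S.q`. -/
def point {A : Type u} [CommRing A] [Algebra k A] (E : ι → ℕ) (S : CongSol P e D d A)
    (w : ι → A⟦X⟧) (i : ι) : A⟦X⟧ :=
  (S.z i : A⟦X⟧) + (S.q : A⟦X⟧) ^ E i * w i

theorem mapAlgHom_point {A B : Type u} [CommRing A] [Algebra k A] [CommRing B] [Algebra k B]
    (φ : A →ₐ[k] B) (E : ι → ℕ) (S : CongSol P e D d A) (w : ι → A⟦X⟧) (i : ι) :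
    PowerSeries.mapAlgHom φ (S.point E w i) =
      (S.map φ).point E (fun i => PowerSeries.mapAlgHom φ (w i)) i := by
  rw [point, map_add, map_mul, map_pow, mapAlgHom_coe, mapAlgHom_coe]
  rfl

theorem redSeries_point {A : TestRing k} (E : ι → ℕ) {S : CongSol P e D d A}
    {S₀ : CongSol P e D d k} (hS : S.map A.reduction = S₀) {w : ι → A⟦X⟧} {w₀ : ι → k⟦X⟧}
    (hw : ∀ i, A.redSeries (w i) = w₀ i) (i : ι) :
    A.redSeries (S.point E w i) = S₀.point E w₀ i := by
  rw [TestRing.redSeries, mapAlgHom_point, hS]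
  congr 1
  funext i
  exact hw i

/-- Solutions of the congruences together with quotients, such that the resulting vector of power
series solves the system `f`. -/
def liftNbhd {J : Type} (f : J → MvPolynomial ι k) (E : ι → ℕ) (S₀ : CongSol P e D d k)
    (w₀ : ι → k⟦X⟧) : TestRing k ⥤ Type u :=
  TestRing.typeFunctor (fun A => { x : CongSol P e D d A × (ι → A⟦X⟧) //
      x.1.map A.reduction = S₀ ∧ (∀ i, A.redSeries (x.2 i) = w₀ i) ∧
        ∀ j, MvPolynomial.aeval (x.1.point E x.2) (f j) = 0 })
    (fun {A B} φ x => ⟨(x.1.1.map φ, fun i => PowerSeries.mapAlgHom φ (x.1.2 i)), by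
      rw [← map_comp, A.eq_reduction (B.reduction.comp φ)]
      exact x.2.1, fun i => by rw [TestRing.redSeries_mapAlgHom, x.2.2.1], fun j => by
      have h := MvPolynomial.comp_aeval_apply (x.1.1.point E x.1.2) (PowerSeries.mapAlgHom φ) (f j)
      rw [x.2.2.2, map_zero] at h
      rw [h]
      congr 2
      funext i
      exact (mapAlgHom_point _ _ _ _ _).symm⟩)
    (fun A x => Subtype.ext (Prod.ext (map_id _) (funext fun i => by
      change PowerSeries.mapAlgHom (AlgHom.id k A) (x.1.2 i) = _
      rw [mapAlgHom_id, AlgHom.id_apply])))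
    (fun A B C φ ψ x => Subtype.ext (Prod.ext (map_comp _ _ _) (funext fun i => by
      change PowerSeries.mapAlgHom (ψ.comp φ) (x.1.2 i) = _
      rw [mapAlgHom_comp]
      rfl)))

end CongSol

section Core

open MvPolynomial

variable {k : Type u} [Field k] {σ τ : Type} [Fintype σ] [Fintype τ] [DecidableEq τ]
  {f : τ → MvPolynomial (σ ⊕ τ) k} {c₀ : σ ⊕ τ → k⟦X⟧} {d r : ℕ}
  {S₀ : CongSol (newtonSystem f) (newtonExp r) (fun i => newtonPrec r i * d) d k}
  {w₀ : σ ⊕ τ → k⟦X⟧}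

/-- If `q` divides `g` and the reduction of `g` has order `deg q`, the quotient is a unit. -/
theorem TestRing.isUnit_of_eq_mul {A : TestRing k} {q : A[X]}
    (hq : q.map A.reduction.toRingHom = Polynomial.X ^ d) {g v : A⟦X⟧}
    (hg : (A.redSeries g).order = d) (h : g = q * v) : IsUnit v := by
  refine A.isUnit_of_isUnit_redSeries ?_
  have h1 := A.redSeries_coe_pow hq 1
  rw [pow_one, one_mul] at h1
  have h2 : A.redSeries g = PowerSeries.X ^ d * A.redSeries v := by rw [h, map_mul, h1]
  rw [h2, PowerSeries.order_mul, PowerSeries.order_X_pow] at hg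
  have h3 : (A.redSeries v).order = 0 := by
    have : (d : ℕ∞) + (A.redSeries v).order = d + 0 := by rw [hg, add_zero]
    exact ENat.add_right_injective_of_ne_top (ENat.natCast_ne_top d) this
  rw [PowerSeries.isUnit_iff_constantCoeff, isUnit_iff_ne_zero]
  intro h0
  have := PowerSeries.order_ne_zero_iff_constCoeff_eq_zero.2 h0
  exact this h3

theorem redSeries_aeval {A : TestRing k} {ι : Type} {c : ι → A⟦X⟧} {c₀ : ι → k⟦X⟧}
    (hc : ∀ i, A.redSeries (c i) = c₀ i) (p : MvPolynomial ι k) :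
    A.redSeries (aeval c p) = aeval c₀ p := by
  rw [comp_aeval_apply]
  congr 2
  funext i
  exact hc i

/-- Weierstrass preparation and division identify arcs with solutions of the congruences together
with quotients. -/
theorem nonempty_liftNbhd_iso_arcPoints (hr : 1 ≤ r)
    (hd : (aeval c₀ (jac f).det).order = d) (hq : S₀.q = Polynomial.X ^ d)
    (hw : ∀ i, S₀.point (newtonPrec r) w₀ i = c₀ i) :
    Nonempty (S₀.liftNbhd f (newtonPrec r) w₀ ≅ arcPoints f c₀) := by
  have hqA : ∀ {A : TestRing k} {S : CongSol (newtonSystem f) (newtonExp r)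
      (fun i => newtonPrec r i * d) d A}, S.map A.reduction = S₀ →
      S.q.map A.reduction.toRingHom = Polynomial.X ^ d := by
    intro A S hS
    rw [← hq, ← hS]
    rfl
  have hred : ∀ (A : TestRing k) (x : (S₀.liftNbhd f (newtonPrec r) w₀).obj A) (i : σ ⊕ τ),
      A.redSeries (x.1.1.point (newtonPrec r) x.1.2 i) = c₀ i := fun A x i => by
    rw [CongSol.redSeries_point _ x.2.1 x.2.2.1, hw]
  -- The congruences give divisibility of the determinant by `q`. The cofactor is a unit because the
  -- determinant reduces to a series of order `d`, the degree of `q`. So `q` is the Weierstrass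
  -- polynomial of the determinant and can be recovered from the arc.
  have hfac : ∀ (A : TestRing k) (x : (S₀.liftNbhd f (newtonPrec r) w₀).obj A),
      ∃ v, IsUnit v ∧ aeval (x.1.1.point (newtonPrec r) x.1.2) (jac f).det = x.1.1.q * v := by
    intro A x
    have h1 := newtonSystem_dvd_of_congr f hr (q := (x.1.1.q : A⟦X⟧))
      (c := fun i => (x.1.1.z i : A⟦X⟧)) (c' := x.1.1.point (newtonPrec r) x.1.2)
      (fun i => by rw [CongSol.point, add_sub_cancel_left]; exact Dvd.intro _ rfl)
      (fun l => by
        rw [aeval_coe_powerSeries, A.coe_dvd_coe_iff x.1.1.q_mem (hqA x.2.1)]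
        exact x.1.1.dvd l) none
    obtain ⟨v, hv⟩ := h1
    have hv' : aeval (x.1.1.point (newtonPrec r) x.1.2) (jac f).det = x.1.1.q * v := by
      simpa [newtonExp, newtonSystem] using hv
    refine ⟨v, TestRing.isUnit_of_eq_mul (hqA x.2.1) ?_ hv', hv'⟩
    rw [redSeries_aeval (hred A x), hd]
  refine nonempty_iso_of_bijective (fun A x => ⟨x.1.1.point (newtonPrec r) x.1.2, x.2.2.2,
    hred A x⟩) ?_ ?_
  · intro A B φ x
    exact Subtype.ext (funext fun i => (CongSol.mapAlgHom_point _ _ _ _ _).symm)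
  · intro A
    constructor
    · intro x y hxy
      have hp : ∀ i, x.1.1.point (newtonPrec r) x.1.2 i = y.1.1.point (newtonPrec r) y.1.2 i :=
        fun i => congrFun (Subtype.ext_iff.1 hxy) i
      obtain ⟨v, hv, hxv⟩ := hfac A x
      obtain ⟨v', hv', hyv⟩ := hfac A y
      have hqq : x.1.1.q = y.1.1.q := by
        refine A.weierstrass_factorization_unique x.1.1.q_mem (hqA x.2.1) y.1.1.q_mem
          (hqA y.2.1) hv hv' ?_
        rw [← hxv, ← hyv, funext hp]
      have hdiv : ∀ i, x.1.2 i = y.1.2 i ∧ x.1.1.z i = y.1.1.z i := by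
        intro i
        refine A.weierstrass_division_unique (hqA x.2.1) (x.1.1.z_mem i) (y.1.1.z_mem i) ?_
        have := hp i
        rw [CongSol.point, CongSol.point, ← hqq] at this
        exact this
      refine Subtype.ext (Prod.ext (CongSol.ext hqq (funext fun i => (hdiv i).2))
        (funext fun i => (hdiv i).1))
    · rintro ⟨c, hc, hcred⟩
      obtain ⟨q, v, hq1, hq2, hv, hdet⟩ := A.exists_weierstrass_factorization
        (g := aeval c (jac f).det) (by rw [redSeries_aeval hcred, hd])
      choose w z hz hcz using fun i => A.exists_weierstrass_division hq2 (newtonPrec r i) (c i)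
      have hdvd : ∀ l, q ^ newtonExp r l ∣ aeval z (newtonSystem f l) := by
        intro l
        rw [← A.coe_dvd_coe_iff hq1 hq2, ← aeval_coe_powerSeries]
        refine newtonSystem_dvd_of_congr f hr (c := c) (fun i => ?_)
          (newtonSystem_dvd_of_eq_zero f r hc ⟨v, hdet⟩) l
        rw [hcz, sub_add_cancel_left, dvd_neg]
        exact Dvd.intro _ rfl
      have hpt : (⟨q, z, hq1, hz, hdvd⟩ : CongSol (newtonSystem f) (newtonExp r)
          (fun i => newtonPrec r i * d) d A).point (newtonPrec r) w = c :=
        funext fun i => (hcz i).symm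
      -- Over `k` the divisor is a power of `t`, so comparing coefficients below and above its
      -- exponent separates remainder and quotient.
      have hmatch : ∀ i, A.redSeries (w i) = w₀ i ∧
          (z i).map A.reduction.toRingHom = S₀.z i := by
        intro i
        have h1 := hcred i
        rw [hcz, map_add, map_mul, A.redSeries_coe_pow hq2, A.redSeries_coe, ← hw i,
          CongSol.point, hq, Polynomial.coe_pow, Polynomial.coe_X, ← pow_mul,
          mul_comm d] at h1
        have h2 := map_mem_degreeLT A.reduction.toRingHom (hz i)
        have h3 : (z i).map A.reduction.toRingHom = S₀.z i := by
          ext m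
          by_cases hm : m < newtonPrec r i * d
          · have := congrArg (PowerSeries.coeff m) h1
            simpa [PowerSeries.coeff_X_pow_mul', not_le.2 hm] using this
          · have h4 := S₀.z_mem i
            rw [Polynomial.mem_degreeLT] at h2 h4
            rw [Polynomial.coeff_eq_zero_of_degree_lt (h2.trans_le (by
              exact_mod_cast not_lt.1 hm)), Polynomial.coeff_eq_zero_of_degree_lt (h4.trans_le (by
              exact_mod_cast not_lt.1 hm))]
        rw [h3] at h1
        exact ⟨mul_left_cancel₀ (pow_ne_zero _ PowerSeries.X_ne_zero) (add_left_cancel h1), h3⟩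
      refine ⟨⟨(⟨q, z, hq1, hz, hdvd⟩, w), ?_, fun i => (hmatch i).1, fun j => ?_⟩, ?_⟩
      · exact CongSol.ext (hq2.trans hq.symm) (funext fun i => (hmatch i).2)
      · rw [hpt]
        exact hc j
      · exact Subtype.ext hpt

end Core


section Core

open MvPolynomial

variable {k : Type u} [Field k] {σ τ : Type} [Fintype σ] [Fintype τ] [DecidableEq τ]
  {f : τ → MvPolynomial (σ ⊕ τ) k} {c₀ : σ ⊕ τ → k⟦X⟧} {d r : ℕ}
  {S₀ : CongSol (newtonSystem f) (newtonExp r) (fun i => newtonPrec r i * d) d k}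
  {w₀ : σ ⊕ τ → k⟦X⟧}

/-- By Newton's method the quotients in the variables indexed by `τ` are determined by the solution
of the congruences and the quotients in the variables indexed by `σ`. -/
theorem nonempty_liftNbhd_iso_prod (hr : 1 ≤ r) (hf : ∀ j, aeval c₀ (f j) = 0)
    (hd : (aeval c₀ (jac f).det).order = d) (hq : S₀.q = Polynomial.X ^ d)
    (hw : ∀ i, S₀.point (newtonPrec r) w₀ i = c₀ i) :
    Nonempty (S₀.liftNbhd f (newtonPrec r) w₀ ≅
      FunctorToTypes.prod S₀.nbhd (TestRing.seriesNbhd fun i => w₀ (Sum.inl i))) := by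
  have hqA : ∀ {A : TestRing k} {S : CongSol (newtonSystem f) (newtonExp r)
      (fun i => newtonPrec r i * d) d A}, S.map A.reduction = S₀ →
      S.q.map A.reduction.toRingHom = Polynomial.X ^ d := by
    intro A S hS
    rw [← hq, ← hS]
    rfl
  have hfac : ∀ (A : TestRing k) (S : CongSol (newtonSystem f) (newtonExp r)
      (fun i => newtonPrec r i * d) d A) (_ : S.map A.reduction = S₀) (w : σ ⊕ τ → A⟦X⟧)
      (_ : ∀ i, A.redSeries (w i) = w₀ i),
      (∀ l, (S.q : A⟦X⟧) ^ newtonExp r l ∣ aeval (S.point (newtonPrec r) w) (newtonSystem f l)) ∧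
      ∃ v, IsUnit v ∧ aeval (S.point (newtonPrec r) w) (jac f).det = S.q * v := by
    intro A S hS w hwA
    have h1 := newtonSystem_dvd_of_congr f hr (q := (S.q : A⟦X⟧))
      (c := fun i => (S.z i : A⟦X⟧)) (c' := S.point (newtonPrec r) w)
      (fun i => by rw [CongSol.point, add_sub_cancel_left]; exact Dvd.intro _ rfl)
      (fun l => by
        rw [aeval_coe_powerSeries, A.coe_dvd_coe_iff S.q_mem (hqA hS)]
        exact S.dvd l)
    refine ⟨h1, ?_⟩
    obtain ⟨v, hv⟩ := h1 none
    have hv' : aeval (S.point (newtonPrec r) w) (jac f).det = S.q * v := by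
      simpa [newtonExp, newtonSystem] using hv
    refine ⟨v, TestRing.isUnit_of_eq_mul (hqA hS) ?_ hv', hv'⟩
    rw [redSeries_aeval fun i => (CongSol.redSeries_point _ hS hwA i).trans (hw i), hd]
  refine nonempty_iso_of_bijective (fun A x => (⟨x.1.1, x.2.1⟩,
    ⟨fun i => x.1.2 (Sum.inl i), fun i => x.2.2.1 _⟩)) (fun A B φ x => rfl) ?_
  intro A
  constructor
  · intro x y hxy
    obtain ⟨⟨S, w⟩, hS, hwA, hx⟩ := x
    obtain ⟨⟨S', w'⟩, hS', hwA', hy⟩ := y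
    have hSS : S = S' := congrArg (fun z => z.1.1) hxy
    subst hSS
    have hl : ∀ i, w (Sum.inl i) = w' (Sum.inl i) := fun i => congrArg (fun z => z.2.1 i) hxy
    obtain ⟨-, v, hv, hdet⟩ := hfac A S hS w hwA
    have h0 := eq_of_newton f hr A.isNilpotent_ker_redSeries
      (A.coe_mem_nonZeroDivisors (hqA hS)) hv hdet (c' := S.point (newtonPrec r) w')
      (fun i => by rw [CongSol.point, CongSol.point, hl])
      (ζ := fun j => w' (Sum.inr j) - w (Sum.inr j))
      (fun j => by rw [RingHom.mem_ker, map_sub, hwA, hwA', sub_self])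
      (fun j => by rw [CongSol.point, CongSol.point, add_sub_add_left_eq_sub, mul_sub]; rfl) hx hy
    have hww : w = w' := by
      funext i
      rcases i with i | j
      · exact hl i
      · exact (sub_eq_zero.1 (congrFun h0 j)).symm
    subst hww
    rfl
  · rintro ⟨⟨S, hS⟩, ⟨w, hwA⟩⟩
    -- Any quotients for `τ` with the correct reduction would serve as a starting point; constant
    -- lifts are one choice.
    set w₁ : σ ⊕ τ → A⟦X⟧ := Sum.elim w fun j => A.liftSeries (w₀ (Sum.inr j)) with hw₁
    have hw₁A : ∀ i, A.redSeries (w₁ i) = w₀ i := by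
      rintro (i | j)
      · exact hwA i
      · exact A.redSeries_liftSeries _
    obtain ⟨hdvd, v, hv, hdet⟩ := hfac A S hS w₁ hw₁A
    have hred : ∀ i, A.redSeries (S.point (newtonPrec r) w₁ i) = c₀ i := fun i =>
      (CongSol.redSeries_point _ hS hw₁A i).trans (hw i)
    -- The congruences give `adjMul f = q ^ (r + 1) * a`. Reducing, the left side becomes its value
    -- at `c₀`, which is zero, while `q` becomes a power of `t`; hence `a` lies in the nilpotent
    -- kernel, as the iteration requires.
    obtain ⟨ζ, hζ, hζ0⟩ := exists_newton f (S.point (newtonPrec r) w₁) hr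
      A.isNilpotent_ker_redSeries (A.coe_mem_nonZeroDivisors (hqA hS)) hv hdet (fun j => by
        obtain ⟨a, ha⟩ := hdvd (some (Sum.inr j))
        refine Ideal.mem_span_singleton_mul.2 ⟨a, ?_, ha.symm⟩
        have h1 := congrArg A.redSeries ha
        rw [redSeries_aeval hred, map_mul, A.redSeries_coe_pow (hqA hS)] at h1
        have h2 : aeval c₀ (newtonSystem f (some (Sum.inr j))) = 0 := adjMul_eq_zero f hf j
        rw [h2, eq_comm, mul_eq_zero] at h1
        exact h1.resolve_left (pow_ne_zero _ PowerSeries.X_ne_zero))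
    refine ⟨⟨(S, w₁ + Sum.elim (fun _ => 0) ζ), hS, fun i => ?_, fun j => ?_⟩, ?_⟩
    · rcases i with i | j
      · simpa using hw₁A (Sum.inl i)
      · have := hζ j
        rw [RingHom.mem_ker] at this
        simpa [this] using hw₁A (Sum.inr j)
    · refine Eq.trans ?_ (hζ0 j)
      congr 2
      funext i
      rcases i with i | j
      · simp [CongSol.point]
      · simp [CongSol.point, newtonPrec, mul_add, add_assoc]
    · refine Prod.ext rfl (Subtype.ext (funext fun i => ?_))
      simp [hw₁]

/-- The reference quotients `w₀` are the tails of `c₀` beyond the truncation. The two descriptions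
of `liftNbhd` are then composed, and the free quotients in the variables `σ` are identified with
`D^∞`. -/
theorem nonempty_arcPoints_iso [Nonempty σ] (hr : 1 ≤ r) (hf : ∀ j, aeval c₀ (f j) = 0)
    (hd : (aeval c₀ (jac f).det).order = d) (hq : S₀.q = Polynomial.X ^ d)
    (hz : ∀ i, S₀.z i = PowerSeries.trunc (newtonPrec r i * d) (c₀ i)) :
    Nonempty (arcPoints f c₀ ≅ FunctorToTypes.prod S₀.nbhd (formalDiscPow k)) := by
  have hex : ∀ i, ∃ w, S₀.point (newtonPrec r) (fun _ => w) i = c₀ i := by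
    intro i
    refine ⟨PowerSeries.mk fun m => PowerSeries.coeff (m + newtonPrec r i * d) (c₀ i), ?_⟩
    conv_rhs => rw [PowerSeries.eq_X_pow_mul_shift_add_trunc (newtonPrec r i * d) (c₀ i)]
    rw [CongSol.point, hq, hz, add_comm, Polynomial.coe_pow, Polynomial.coe_X, ← pow_mul,
      mul_comm d]
  choose w₀ hw₀ using hex
  obtain ⟨α⟩ := nonempty_liftNbhd_iso_arcPoints (f := f) hr hd hq (w₀ := w₀) hw₀
  obtain ⟨β⟩ := nonempty_liftNbhd_iso_prod (f := f) hr hf hd hq (w₀ := w₀) hw₀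
  obtain ⟨γ⟩ := TestRing.nonempty_formalDiscPow_iso_seriesNbhd (k := k)
    fun i : σ => w₀ (Sum.inl i)
  refine ⟨α.symm ≪≫ β ≪≫ Nonempty.some ?_⟩
  refine nonempty_iso_of_bijective (fun A x => (x.1, γ.inv.app A x.2)) ?_ ?_
  · intro A B φ x
    exact Prod.ext rfl (NatTrans.naturality_apply γ.inv φ x.2)
  · intro A
    exact ((Equiv.refl _).prodCongr (γ.symm.app A).toEquiv).bijective

end Core


/-! ### The finitely generated algebra representing solutions of the congruences. -/

namespace CongSol

section Corepresentable

variable {k : Type u} [Field k] {ι Λ : Type} (P : Λ → MvPolynomial ι k) (e : Λ → ℕ)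
  (D : ι → ℕ) (d : ℕ)

/-- The coefficients of a solution of congruences. -/
abbrev Coeffs : Type := Fin d ⊕ (Σ i : ι, Fin (D i))

variable {D d}

/-- The monic polynomial with given coefficients. -/
def coeffPoly {R : Type u} [CommRing R] (v : Coeffs D d → R) : R[X] :=
  Polynomial.X ^ d + ((Polynomial.degreeLTEquiv R d).symm fun i => v (Sum.inl i)).1

/-- The vector of polynomials with given coefficients. -/
def coeffVec {R : Type u} [CommRing R] (v : Coeffs D d → R) (i : ι) : R[X] :=
  ((Polynomial.degreeLTEquiv R (D i)).symm fun m => v (Sum.inr ⟨i, m⟩)).1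

theorem _root_.Polynomial.coeff_degreeLTEquiv_symm {R : Type*} [CommRing R] {n : ℕ} (v : Fin n → R)
    (m : Fin n) : (((Polynomial.degreeLTEquiv R n).symm v).1).coeff m = v m :=
  congrFun ((Polynomial.degreeLTEquiv R n).apply_symm_apply v) m

theorem _root_.Polynomial.ext_of_mem_degreeLT {R : Type*} [CommRing R] {n : ℕ} {p q : R[X]}
    (hp : p ∈ Polynomial.degreeLT R n) (hq : q ∈ Polynomial.degreeLT R n)
    (h : ∀ m : Fin n, p.coeff m = q.coeff m) : p = q := by
  have : (⟨p, hp⟩ : Polynomial.degreeLT R n) = ⟨q, hq⟩ :=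
    (Polynomial.degreeLTEquiv R n).injective (funext h)
  exact Subtype.ext_iff.1 this

theorem _root_.Polynomial.map_degreeLTEquiv_symm {R S : Type u} [CommRing R] [CommRing S]
    (φ : R →+* S) {n : ℕ} (v : Fin n → R) :
    ((Polynomial.degreeLTEquiv R n).symm v).1.map φ =
      ((Polynomial.degreeLTEquiv S n).symm fun i => φ (v i)).1 := by
  refine Polynomial.ext_of_mem_degreeLT (map_mem_degreeLT φ (Subtype.mem _)) (Subtype.mem _) ?_
  intro m
  rw [Polynomial.coeff_map, Polynomial.coeff_degreeLTEquiv_symm,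
    Polynomial.coeff_degreeLTEquiv_symm]

theorem map_coeffPoly {R S : Type u} [CommRing R] [CommRing S] (φ : R →+* S)
    (v : Coeffs D d → R) : (coeffPoly v).map φ = coeffPoly fun i => φ (v i) := by
  rw [coeffPoly, Polynomial.map_add, Polynomial.map_degreeLTEquiv_symm, Polynomial.map_pow,
    Polynomial.map_X]
  rfl

theorem map_coeffVec {R S : Type u} [CommRing R] [CommRing S] (φ : R →+* S)
    (v : Coeffs D d → R) (i : ι) : (coeffVec v i).map φ = coeffVec (fun i => φ (v i)) i :=
  Polynomial.map_degreeLTEquiv_symm φ _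

theorem coeffPoly_mem {R : Type u} [CommRing R] (v : Coeffs D d → R) :
    coeffPoly v - Polynomial.X ^ d ∈ Polynomial.degreeLT R d := by
  rw [coeffPoly, add_sub_cancel_left]
  exact Subtype.mem _

theorem coeffVec_mem {R : Type u} [CommRing R] (v : Coeffs D d → R) (i : ι) :
    coeffVec v i ∈ Polynomial.degreeLT R (D i) :=
  Subtype.mem _

variable {P e}

/-- The coefficients of a solution of congruences. -/
def coeffs {R : Type u} [CommRing R] [Algebra k R] (S : CongSol P e D d R) : Coeffs D d → R :=
  Sum.elim (fun m => (S.q - Polynomial.X ^ d).coeff m) fun x => (S.z x.1).coeff x.2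

theorem coeffPoly_coeffs {R : Type u} [CommRing R] [Algebra k R] (S : CongSol P e D d R) :
    coeffPoly S.coeffs = S.q := by
  have h := Polynomial.ext_of_mem_degreeLT (coeffPoly_mem S.coeffs) S.q_mem fun m => by
    rw [coeffPoly, add_sub_cancel_left, Polynomial.coeff_degreeLTEquiv_symm]
    rfl
  simpa using h

theorem coeffVec_coeffs {R : Type u} [CommRing R] [Algebra k R] (S : CongSol P e D d R) :
    coeffVec S.coeffs = S.z :=
  funext fun i => Polynomial.ext_of_mem_degreeLT (coeffVec_mem _ _) (S.z_mem i) fun m => by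
    rw [coeffVec, Polynomial.coeff_degreeLTEquiv_symm]
    rfl

theorem coeffs_eq {R : Type u} [CommRing R] [Algebra k R] {v : Coeffs D d → R}
    {S : CongSol P e D d R} (hq : S.q = coeffPoly v) (hz : S.z = coeffVec v) : S.coeffs = v := by
  funext x
  rcases x with m | ⟨i, m⟩
  · simp only [coeffs, Sum.elim_inl]
    rw [hq, coeffPoly, add_sub_cancel_left, Polynomial.coeff_degreeLTEquiv_symm]
  · simp only [coeffs, Sum.elim_inr]
    rw [hz, coeffVec, Polynomial.coeff_degreeLTEquiv_symm]

variable (P e D d) in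
/-- The ideal of conditions on the coefficients of a solution of congruences. -/
def relations : Ideal (MvPolynomial (Coeffs D d) k) :=
  Ideal.span { a | ∃ (l : Λ) (n : ℕ),
    a = (MvPolynomial.aeval (coeffVec MvPolynomial.X) (P l) %ₘ
      (coeffPoly (MvPolynomial.X : Coeffs D d → MvPolynomial (Coeffs D d) k)) ^ e l).coeff n }

variable (P e D d) in
/-- The algebra representing the solutions of congruences. -/
abbrev algebra : Type u := MvPolynomial (Coeffs D d) k ⧸ relations P e D d

/-- Division by a monic polynomial commutes with base change, so divisibility over any `R` is the
vanishing of the specialised coefficients of the universal remainder. -/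
theorem map_modByMonic_relation {R : Type u} [CommRing R] [Algebra k R]
    (φ : MvPolynomial (Coeffs D d) k →ₐ[k] R) (l : Λ) :
    (MvPolynomial.aeval (coeffVec MvPolynomial.X) (P l) %ₘ
      (coeffPoly (MvPolynomial.X : Coeffs D d → MvPolynomial (Coeffs D d) k)) ^ e l).map
        φ.toRingHom =
      MvPolynomial.aeval (coeffVec fun i => φ (MvPolynomial.X i)) (P l) %ₘ
        (coeffPoly fun i => φ (MvPolynomial.X i)) ^ e l := by
  rw [Polynomial.map_modByMonic _
    ((Polynomial.monic_of_sub_mem_degreeLT (coeffPoly_mem _)).pow _), Polynomial.map_pow,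
    map_coeffPoly, Polynomial.map_aeval_mvPolynomial]
  congr 3
  funext i
  exact map_coeffVec _ _ _

theorem aeval_relation_iff {R : Type u} [CommRing R] [Algebra k R]
    (φ : MvPolynomial (Coeffs D d) k →ₐ[k] R) :
    (∀ a ∈ relations P e D d, φ a = 0) ↔
      ∀ l, (coeffPoly fun i => φ (MvPolynomial.X i)) ^ e l ∣
        MvPolynomial.aeval (coeffVec fun i => φ (MvPolynomial.X i)) (P l) := by
  have h1 : ∀ l, (coeffPoly fun i => φ (MvPolynomial.X i)) ^ e l ∣
        MvPolynomial.aeval (coeffVec fun i => φ (MvPolynomial.X i)) (P l) ↔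
      ∀ n, φ ((MvPolynomial.aeval (coeffVec MvPolynomial.X) (P l) %ₘ
        (coeffPoly (MvPolynomial.X : Coeffs D d → MvPolynomial (Coeffs D d) k)) ^ e l).coeff n) =
          0 := by
    intro l
    rw [← Polynomial.modByMonic_eq_zero_iff_dvd
      ((Polynomial.monic_of_sub_mem_degreeLT (coeffPoly_mem _)).pow _),
      ← map_modByMonic_relation, Polynomial.ext_iff]
    simp only [Polynomial.coeff_map, Polynomial.coeff_zero]
    rfl
  constructor
  · intro h l
    rw [h1]
    exact fun n => h _ (Ideal.subset_span ⟨l, n, rfl⟩)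
  · intro h
    have : relations P e D d ≤ RingHom.ker φ := by
      rw [relations, Ideal.span_le]
      rintro _ ⟨l, n, rfl⟩
      exact (h1 l).1 (h l) n
    exact this

/-- The solution of congruences corresponding to a point of the representing algebra. -/
def ofHom {R : Type u} [CommRing R] [Algebra k R] (φ : algebra P e D d →ₐ[k] R) :
    CongSol P e D d R where
  q := coeffPoly fun i => φ (Ideal.Quotient.mkₐ k _ (MvPolynomial.X i))
  z := coeffVec fun i => φ (Ideal.Quotient.mkₐ k _ (MvPolynomial.X i))
  q_mem := coeffPoly_mem _
  z_mem := coeffVec_mem _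
  dvd := (aeval_relation_iff (φ.comp (Ideal.Quotient.mkₐ k _))).1 fun a ha => by
    rw [AlgHom.comp_apply, Ideal.Quotient.mkₐ_eq_mk, Ideal.Quotient.eq_zero_iff_mem.2 ha, map_zero]

/-- The point of the representing algebra corresponding to a solution of congruences. -/
def toHom {R : Type u} [CommRing R] [Algebra k R] (S : CongSol P e D d R) :
    algebra P e D d →ₐ[k] R :=
  Ideal.Quotient.liftₐ _ (MvPolynomial.aeval S.coeffs) ((aeval_relation_iff _).2 fun l => by
    simp only [MvPolynomial.aeval_X, coeffPoly_coeffs, coeffVec_coeffs]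
    exact S.dvd l)

theorem toHom_apply {R : Type u} [CommRing R] [Algebra k R] (S : CongSol P e D d R)
    (i : Coeffs D d) : S.toHom (Ideal.Quotient.mkₐ k _ (MvPolynomial.X i)) = S.coeffs i :=
  MvPolynomial.aeval_X _ _

/-- Points of the representing algebra are solutions of congruences. -/
def homEquiv {R : Type u} [CommRing R] [Algebra k R] :
    (algebra P e D d →ₐ[k] R) ≃ CongSol P e D d R where
  toFun := ofHom
  invFun := toHom
  left_inv φ := by
    refine Ideal.Quotient.algHom_ext _ (MvPolynomial.algHom_ext fun i => ?_)
    exact (toHom_apply _ i).trans (congrFun (coeffs_eq (S := ofHom φ)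
      (v := fun i => φ (Ideal.Quotient.mkₐ k _ (MvPolynomial.X i))) rfl rfl) i)
  right_inv S := by
    refine CongSol.ext ?_ ?_
    · change coeffPoly (fun i => S.toHom (Ideal.Quotient.mkₐ k _ (MvPolynomial.X i))) = _
      simp only [toHom_apply]
      exact S.coeffPoly_coeffs
    · change coeffVec (fun i => S.toHom (Ideal.Quotient.mkₐ k _ (MvPolynomial.X i))) = _
      simp only [toHom_apply]
      exact S.coeffVec_coeffs

theorem homEquiv_comp {R T : Type u} [CommRing R] [Algebra k R] [CommRing T] [Algebra k T]
    (φ : algebra P e D d →ₐ[k] R) (ψ : R →ₐ[k] T) :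
    homEquiv (ψ.comp φ) = (homEquiv φ).map ψ := by
  refine CongSol.ext ?_ (funext fun i => ?_)
  · exact (map_coeffPoly ψ.toRingHom
      fun i => φ (Ideal.Quotient.mkₐ k _ (MvPolynomial.X i))).symm
  · exact (map_coeffVec ψ.toRingHom
      (fun i => φ (Ideal.Quotient.mkₐ k _ (MvPolynomial.X i))) i).symm

theorem finiteType_algebra [Finite ι] : Algebra.FiniteType k (algebra P e D d) :=
  have : Algebra.FiniteType k (MvPolynomial (Coeffs D d) k) := inferInstance
  Algebra.FiniteType.of_surjective (Ideal.Quotient.mkₐ k (relations P e D d))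
    (Ideal.Quotient.mkₐ_surjective k _)

end Corepresentable

end CongSol

/-- The formal neighbourhood of a `k`-point of an affine scheme, in terms of algebras. -/
def affineNbhd {k B : Type u} [Field k] [CommRing B] [Algebra k B] (b : B →ₐ[k] k) :
    TestRing k ⥤ Type u :=
  TestRing.typeFunctor (fun A => { φ : B →ₐ[k] A // A.reduction.comp φ = b })
    (fun {A A'} f φ => ⟨f.comp φ.1, by
      rw [← AlgHom.comp_assoc, A.eq_reduction (A'.reduction.comp f), φ.2]⟩)
    (fun _ _ => rfl) (fun _ _ _ _ _ _ => rfl)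

/-! ### Formal neighbourhoods of points of affine schemes in terms of algebras. -/

section Spec

variable {k : Type u} [Field k] {R S : Type u} [CommRing R] [Algebra k R] [CommRing S]
  [Algebra k S]

theorem specMap_injective : Function.Injective (specMap : (R →ₐ[k] S) → _) := by
  intro φ ψ h
  have := Spec.map_injective h
  exact AlgHom.coe_ringHom_injective (congrArg CommRingCat.Hom.hom this)

theorem exists_specMap_eq (γ : Spec (.of S) ⟶ Spec (.of R))
    (hγ : γ ≫ specStr k R = specStr k S) : ∃ φ : R →ₐ[k] S, specMap φ = γ := by
  obtain ⟨g, rfl⟩ := Spec.map_surjective γ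
  rw [specStr, specStr, ← Spec.map_comp] at hγ
  have h := Spec.map_injective hγ
  exact ⟨{ g.hom with commutes' := fun c => congrArg (fun φ => CommRingCat.Hom.hom φ c) h }, rfl⟩

theorem nonempty_formalNbhd_iso_affineNbhd (b : R →ₐ[k] k) :
    Nonempty (affineNbhd b ≅ formalNbhd (specStr k R) (specMap b)) := by
  refine nonempty_iso_of_bijective (fun A φ => ⟨specMap φ.1, specMap_str _, by
    rw [← specMap_comp, φ.2]⟩) ?_ ?_
  · intro A B f φ
    exact Subtype.ext (specMap_comp _ _)
  · intro A
    constructor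
    · intro φ ψ h
      exact Subtype.ext (specMap_injective (Subtype.ext_iff.1 h))
    · rintro ⟨γ, hγ, hγ'⟩
      obtain ⟨φ, rfl⟩ := exists_specMap_eq γ hγ
      rw [← specMap_comp] at hγ'
      exact ⟨⟨φ, specMap_injective hγ'⟩, rfl⟩

theorem CongSol.nonempty_affineNbhd_iso_nbhd {ι Λ : Type} {P : Λ → MvPolynomial ι k} {e : Λ → ℕ}
    {D : ι → ℕ} {d : ℕ} (b : CongSol.algebra P e D d →ₐ[k] k) :
    Nonempty (affineNbhd b ≅ (CongSol.homEquiv b).nbhd) := by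
  refine nonempty_iso_of_bijective (fun A φ => ⟨CongSol.homEquiv φ.1, by
    rw [← CongSol.homEquiv_comp, φ.2]⟩) ?_ ?_
  · intro A B f φ
    exact Subtype.ext (CongSol.homEquiv_comp _ _)
  · intro A
    constructor
    · intro φ ψ h
      exact Subtype.ext (CongSol.homEquiv.injective (Subtype.ext_iff.1 h))
    · rintro ⟨S, hS⟩
      refine ⟨⟨CongSol.homEquiv.symm S, CongSol.homEquiv.injective ?_⟩,
        Subtype.ext (CongSol.homEquiv.apply_symm_apply S)⟩
      rw [CongSol.homEquiv_comp, Equiv.apply_symm_apply, hS]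

end Spec


/-! ### The hypersurface case. -/

section Hypersurface

open MvPolynomial

variable {k : Type u} [Field k] {n : ℕ} (f : MvPolynomial (Option (Fin n)) k)

/-- The reordering of the variables of a hypersurface. -/
abbrev optionSum (n : ℕ) : Option (Fin n) ≃ Fin n ⊕ Unit := Equiv.optionEquivSumPUnit (Fin n)

/-- The equation of a hypersurface, as a system of one equation. -/
def hypersurfaceSystem : Unit → MvPolynomial (Fin n ⊕ Unit) k := fun _ => rename (optionSum n) f

theorem vec_eq {R : Type u} (x : Fin n → R) (y : R) :
    vec x y = Sum.elim x (fun _ => y) ∘ optionSum n := by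
  funext i
  cases i <;> rfl

theorem elim_eq {R : Type*} (z : Fin n ⊕ Unit → R) :
    Sum.elim (fun i => z (Sum.inl i)) (fun _ => z (Sum.inr ())) = z := by
  funext i
  rcases i with i | ⟨⟩ <;> rfl

theorem det_jac_hypersurfaceSystem :
    (jac (hypersurfaceSystem f)).det = rename (optionSum n) (pderiv none f) := by
  rw [Matrix.det_unique]
  exact pderiv_rename (optionSum n).injective (x := none) f

theorem adjMul_hypersurfaceSystem (j : Unit) :
    adjMul (hypersurfaceSystem f) j = hypersurfaceSystem f () := by
  rw [adjMul, Matrix.adjugate_subsingleton, Matrix.one_mulVec]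

theorem aeval_rename_optionSum {R : Type u} [CommRing R] [Algebra k R] (x : Fin n → R) (y : R)
    (p : MvPolynomial (Option (Fin n)) k) :
    aeval (Sum.elim x fun _ => y) (rename (optionSum n) p) = aeval (vec x y) p := by
  rw [aeval_rename, vec_eq]

/-- The adjugate of a `1 × 1` matrix is `1`, so `adjMul` changes nothing and the determinant is
`∂f/∂y`. The congruence for `f` modulo `q` is implied by the one modulo `q ^ (r + 1)`. -/
theorem newtonSystem_hypersurfaceSystem_dvd_iff {R : Type u} [CommRing R] [Algebra k R]
    (r : ℕ) (q : R) (x : Fin n → R) (y : R) :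
    (∀ l, q ^ newtonExp r l ∣ aeval (Sum.elim x fun _ => y)
        (newtonSystem (hypersurfaceSystem f) l)) ↔
      q ∣ aeval (vec x y) (pderiv none f) ∧ q ^ (r + 1) ∣ aeval (vec x y) f := by
  have h1 : aeval (Sum.elim x fun _ => y) (newtonSystem (hypersurfaceSystem f) none) =
      aeval (vec x y) (pderiv none f) := by
    rw [← aeval_rename_optionSum, ← det_jac_hypersurfaceSystem]
    rfl
  have h2 : ∀ j, aeval (Sum.elim x fun _ => y) (newtonSystem (hypersurfaceSystem f)
      (some (Sum.inl j))) = aeval (vec x y) f := fun j => by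
    rw [← aeval_rename_optionSum]
    rfl
  have h3 : ∀ j, aeval (Sum.elim x fun _ => y) (newtonSystem (hypersurfaceSystem f)
      (some (Sum.inr j))) = aeval (vec x y) f := fun j => by
    rw [← aeval_rename_optionSum]
    exact congrArg _ (adjMul_hypersurfaceSystem f j)
  constructor
  · intro h
    have h4 := h none
    have h5 := h (some (Sum.inr ()))
    rw [h1, newtonExp, pow_one] at h4
    rw [h3] at h5
    exact ⟨h4, h5⟩
  · rintro ⟨h4, h5⟩ (_ | j | j)
    · rwa [h1, newtonExp, pow_one]
    · rw [h2]
      exact (pow_dvd_pow _ (Nat.le_add_left 1 r)).trans h5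
    · rwa [h3]

/-- The triple belonging to a solution of the congruences for the system of one equation. -/
def CongSol.toTriple {d r : ℕ} {R : Type u} [CommRing R] [Algebra k R]
    (S : CongSol (newtonSystem (hypersurfaceSystem f)) (newtonExp r)
      (fun i => newtonPrec r i * d) d R) : Triple f d r R :=
  have h : ∀ l, S.q ^ newtonExp r l ∣ aeval (Sum.elim (fun i => S.z (Sum.inl i))
      fun _ => S.z (Sum.inr ())) (newtonSystem (hypersurfaceSystem f) l) := by
    rw [elim_eq]
    exact S.dvd
  { q := S.q
    x := fun i => S.z (Sum.inl i)
    y := S.z (Sum.inr ())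
    q_mem := S.q_mem
    x_mem := fun i => S.z_mem (Sum.inl i)
    y_mem := S.z_mem (Sum.inr ())
    dvd_pderiv := ((newtonSystem_hypersurfaceSystem_dvd_iff f r S.q _ _).1 h).1
    dvd_eval := ((newtonSystem_hypersurfaceSystem_dvd_iff f r S.q _ _).1 h).2 }

/-- The solution of the congruences for the system of one equation belonging to a triple. -/
def Triple.toCongSol {d r : ℕ} {R : Type u} [CommRing R] [Algebra k R] (T : Triple f d r R) :
    CongSol (newtonSystem (hypersurfaceSystem f)) (newtonExp r) (fun i => newtonPrec r i * d) d R where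
  q := T.q
  z := Sum.elim T.x fun _ => T.y
  q_mem := T.q_mem
  z_mem := by
    rintro (i | i)
    exacts [T.x_mem i, T.y_mem]
  dvd := (newtonSystem_hypersurfaceSystem_dvd_iff f r T.q T.x T.y).2 ⟨T.dvd_pderiv, T.dvd_eval⟩

/-- Triples are solutions of the congruences for the system of one equation. -/
def tripleEquiv (d r : ℕ) (R : Type u) [CommRing R] [Algebra k R] :
    CongSol (newtonSystem (hypersurfaceSystem f)) (newtonExp r) (fun i => newtonPrec r i * d) d R ≃
      Triple f d r R where
  toFun S := S.toTriple f
  invFun T := T.toCongSol f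
  left_inv S := CongSol.ext rfl (elim_eq S.z)
  right_inv _ := rfl

/-- The functor of triples is corepresentable. -/
def tripleFunctorCorepresentableBy (d r : ℕ) :
    (tripleFunctor f d r).CorepresentableBy (CommAlgCat.of k (CongSol.algebra
      (newtonSystem (hypersurfaceSystem f)) (newtonExp r) (fun i => newtonPrec r i * d) d)) where
  homEquiv {Y} := (ConcreteCategory.homEquiv (C := CommAlgCat k)).trans
    (CongSol.homEquiv.trans (tripleEquiv f d r Y))
  homEquiv_comp g φ := congrArg (tripleEquiv f d r _) (CongSol.homEquiv_comp φ.hom g.hom)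

theorem nonempty_hypersurfaceArcFormalNbhd_iso (x₀ : Fin n → k⟦X⟧) (y₀ : k⟦X⟧) :
    Nonempty (hypersurfaceArcFormalNbhd f x₀ y₀ ≅
      arcPoints (hypersurfaceSystem f) (Sum.elim x₀ fun _ => y₀)) := by
  refine nonempty_iso_of_bijective (fun A γ => ⟨γ.1 ∘ (optionSum n).symm, fun j => ?_,
    fun i => ?_⟩) (fun A B φ γ => rfl) ?_
  · rw [hypersurfaceSystem, aeval_rename, Function.comp_assoc, Equiv.symm_comp_self]
    exact γ.2.1
  · refine (γ.2.2 ((optionSum n).symm i)).trans ?_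
    rw [vec_eq, Function.comp_apply, Equiv.apply_symm_apply]
  · intro A
    constructor
    · intro γ γ' h
      refine Subtype.ext ((optionSum n).symm.surjective.injective_comp_right ?_)
      exact Subtype.ext_iff.1 h
    · rintro ⟨c, hc, hc'⟩
      refine ⟨⟨c ∘ optionSum n, ?_, fun i => ?_⟩, Subtype.ext ?_⟩
      · have := hc ()
        rwa [hypersurfaceSystem, aeval_rename] at this
      · rw [vec_eq]
        exact hc' _
      · change (c ∘ optionSum n) ∘ (optionSum n).symm = c
        rw [Function.comp_assoc, Equiv.self_comp_symm, Function.comp_id]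

/-- A nonzero algebraic element of a domain over a field is a unit, but `y` minus its constant term
is not a unit. -/
theorem PowerSeries.eq_C_of_isAlgebraic {y : k⟦X⟧} (h : IsAlgebraic k y) :
    y = algebraMap k k⟦X⟧ (PowerSeries.constantCoeff y) := by
  by_contra hne
  have h1 : IsAlgebraic k (y - algebraMap k k⟦X⟧ (PowerSeries.constantCoeff y)) :=
    h.sub (isAlgebraic_algebraMap _)
  have h2 : IsUnit (y - algebraMap k k⟦X⟧ (PowerSeries.constantCoeff y)) := by
    exact h1.isIntegral.isUnit (sub_ne_zero.2 hne)
  rw [PowerSeries.isUnit_iff_constantCoeff] at h2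
  simp at h2

end Hypersurface


section Hypersurface

open MvPolynomial

variable {k : Type u} [Field k]

/-- This supplies the free variable needed for `D^∞`. With `n = 0` the series `y₀` would be a root
of a nonzero polynomial in one variable, hence constant, and then the derivative would have order
`0` or vanish, contrary to `0 < d < ∞`. -/
theorem hypersurface_dim_pos {n : ℕ} (f : MvPolynomial (Option (Fin n)) k) (x₀ : Fin n → k⟦X⟧)
    (y₀ : k⟦X⟧) {d : ℕ} (hf : aeval (vec x₀ y₀) f = 0)
    (hd : (aeval (vec x₀ y₀) (pderiv none f)).order = d) (hd0 : 0 < d) : Nonempty (Fin n) := by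
  by_contra hn
  rw [not_nonempty_iff] at hn
  have hvec : vec x₀ y₀ = fun _ => y₀ := by
    funext i
    rcases i with _ | i
    · rfl
    · exact hn.elim i
  have hp : ∀ p : MvPolynomial (Option (Fin n)) k,
      aeval (fun _ => y₀) p = Polynomial.aeval y₀ (aeval (fun _ => Polynomial.X) p : k[X]) := by
    intro p
    rw [comp_aeval_apply]
    simp
  have hne : aeval (vec x₀ y₀) (pderiv none f) ≠ 0 := by
    intro h
    rw [h, PowerSeries.order_zero] at hd
    exact ENat.top_ne_natCast d hd
  have hinj : Function.Injective
      (aeval (fun _ => Polynomial.X) : MvPolynomial (Option (Fin n)) k →ₐ[k] k[X]) := by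
    have : (aeval (fun _ => Polynomial.X) : MvPolynomial (Option (Fin n)) k →ₐ[k] k[X]) =
        (uniqueAlgEquiv k (Option (Fin n))).toAlgHom := by
      ext i
      simp
    rw [this]
    exact (uniqueAlgEquiv k (Option (Fin n))).injective
  have halg : IsAlgebraic k y₀ := by
    refine ⟨aeval (fun _ => Polynomial.X) f, ?_, ?_⟩
    · intro h0
      have : f = 0 := hinj (by rw [h0, map_zero])
      exact hne (by rw [this, map_zero, map_zero])
    · rw [← hp, ← hvec, hf]
  have hy := PowerSeries.eq_C_of_isAlgebraic halg
  rw [hvec, hp, hy, Polynomial.aeval_algebraMap_apply] at hd hne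
  have h1 : ((algebraMap k k⟦X⟧) (Polynomial.aeval (PowerSeries.constantCoeff y₀)
      (aeval (fun _ => Polynomial.X) (pderiv none f) : k[X]))).order = 0 := by
    refine PowerSeries.order_zero_of_unit ((IsUnit.mk0 _ fun h0 => hne ?_).map _)
    rw [h0, map_zero]
  rw [h1] at hd
  exact hd0.ne (by exact_mod_cast hd)

/-- The arc functor is defined by the single equation `f` itself, so the product decomposition
applies directly, with `σ = Fin n` and `τ` a point. -/
theorem hypersurface_formal_arc_theorem (n : ℕ) (f : MvPolynomial (Option (Fin n)) k)
    (x₀ : Fin n → k⟦X⟧) (y₀ : k⟦X⟧) (d r : ℕ) (hf : aeval (vec x₀ y₀) f = 0)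
    (hd : (aeval (vec x₀ y₀) (pderiv none f)).order = d) (hd0 : 0 < d) (hr : 1 < r) :
    ∃ (B : CommAlgCat.{u} k) (e : (tripleFunctor f d r).CorepresentableBy B) (b : B →ₐ[k] k),
        Algebra.FiniteType k B ∧
        (e.homEquiv (CommAlgCat.ofHom b)).q = Polynomial.X ^ d ∧
        (∀ i, (e.homEquiv (CommAlgCat.ofHom b)).x i =
          PowerSeries.trunc ((r + 1) * d) (x₀ i)) ∧
        (e.homEquiv (CommAlgCat.ofHom b)).y = PowerSeries.trunc (r * d) y₀ ∧
        Nonempty (hypersurfaceArcFormalNbhd f x₀ y₀ ≅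
          FunctorToTypes.prod
            (formalNbhd (specStr k B) (specMap b))
            (formalDiscPow k)) := by
  have := hypersurface_dim_pos f x₀ y₀ hf hd hd0
  have hf' : ∀ j, aeval (Sum.elim x₀ fun _ => y₀) (hypersurfaceSystem f j) = 0 := fun j => by
    rw [hypersurfaceSystem, aeval_rename_optionSum, hf]
  have hd' : (aeval (Sum.elim x₀ fun _ => y₀) (jac (hypersurfaceSystem f)).det).order = d := by
    rw [det_jac_hypersurfaceSystem, aeval_rename_optionSum, hd]
  obtain ⟨S₀, hq, hz⟩ := exists_congSol (hypersurfaceSystem f) hr.le hf' hd'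
  have hS₀ : CongSol.homEquiv (CongSol.homEquiv.symm S₀) = S₀ :=
    CongSol.homEquiv.apply_symm_apply S₀
  have he : (tripleFunctorCorepresentableBy f d r).homEquiv
      (CommAlgCat.ofHom (CongSol.homEquiv.symm S₀)) = S₀.toTriple f :=
    congrArg (CongSol.toTriple f) hS₀
  refine ⟨_, tripleFunctorCorepresentableBy f d r, CongSol.homEquiv.symm S₀,
    CongSol.finiteType_algebra, ?_, ?_, ?_, ?_⟩
  · rw [he]
    exact hq
  · rw [he]
    exact fun i => hz (Sum.inl i)
  · rw [he]
    exact hz (Sum.inr ())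
  · obtain ⟨α⟩ := nonempty_hypersurfaceArcFormalNbhd_iso f x₀ y₀
    obtain ⟨β⟩ := nonempty_arcPoints_iso hr.le hf' hd' hq hz
    obtain ⟨γ⟩ := CongSol.nonempty_affineNbhd_iso_nbhd (CongSol.homEquiv.symm S₀)
    rw [hS₀] at γ
    obtain ⟨δ⟩ := nonempty_formalNbhd_iso_affineNbhd (CongSol.homEquiv.symm S₀)
    obtain ⟨ε⟩ := nonempty_prod_iso (γ.symm ≪≫ δ) (formalDiscPow k)
    exact ⟨α ≪≫ β ≪≫ ε⟩

end Hypersurface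


/-! ### Choosing equations adapted to an arc. -/

section LinearAlgebra

/-- A set of vectors contains a finite family with the same span having a nonvanishing minor. -/
theorem exists_minor_ne_zero {K : Type*} [Field K] {ι : Type} [Finite ι] (V : Set (ι → K)) :
    ∃ (τ : Type) (_ : Fintype τ) (_ : DecidableEq τ) (a : τ → ι) (v : τ → ι → K),
      Function.Injective a ∧ (∀ j, v j ∈ V) ∧ (Matrix.of fun i j => v i (a j)).det ≠ 0 ∧
        V ⊆ Submodule.span K (Set.range v) := by
  classical
  have := Fintype.ofFinite ι
  obtain ⟨b, hbV, hb, hli⟩ := exists_linearIndependent K V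
  have : Finite b := hli.finite
  have := Fintype.ofFinite b
  let M : Matrix b ι K := Matrix.of fun i => i.1
  obtain ⟨τ, a, ha, hspan, hcol⟩ := exists_linearIndependent' K M.col
  have : Finite τ := Finite.of_injective a ha
  have := Fintype.ofFinite τ
  -- Equality of row rank and column rank makes the chosen submatrix square.
  have hcard : Fintype.card τ = Fintype.card b := by
    rw [← LinearIndependent.rank_matrix (M := M) hli, Matrix.rank_eq_finrank_span_cols, ← hspan,
      finrank_span_eq_card hcol]
  let ε : τ ≃ b := Fintype.equivOfCardEq hcard
  refine ⟨τ, inferInstance, inferInstance, a, fun j => (ε j).1, ha, fun j => hbV (ε j).2, ?_, ?_⟩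
  · rw [← isUnit_iff_ne_zero, ← Matrix.isUnit_iff_isUnit_det,
      ← Matrix.linearIndependent_cols_iff_isUnit]
    exact hcol.map' (LinearEquiv.funCongrLeft K K ε).toLinearMap
      (LinearEquiv.ker _)
  · have : Set.range (fun j => (ε j).1) = b := by
      ext x
      constructor
      · rintro ⟨j, rfl⟩
        exact (ε j).2
      · intro hx
        exact ⟨ε.symm ⟨x, hx⟩, by simp⟩
    rw [this, hb]
    exact Submodule.subset_span

/-- A linear combination over the fraction field, with denominators cleared. -/
theorem exists_smul_eq_sum_of_mem_span {D K ι τ : Type*} [CommRing D] [IsDomain D] [Field K]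
    [Algebra D K] [IsFractionRing D K] [Fintype τ] {v : τ → ι → D} {w : ι → D}
    (h : (fun i => algebraMap D K (w i)) ∈
      Submodule.span K (Set.range fun j i => algebraMap D K (v j i))) :
    ∃ (b : D) (a : τ → D), b ≠ 0 ∧ ∀ i, b * w i = ∑ j, a j * v j i := by
  obtain ⟨c, hc⟩ := (Submodule.mem_span_range_iff_exists_fun K).1 h
  obtain ⟨b, hb⟩ := IsLocalization.exist_integer_multiples_of_finite (nonZeroDivisors D) c
  choose a ha using hb
  refine ⟨b, a, nonZeroDivisors.ne_zero b.2, fun i => IsFractionRing.injective D K ?_⟩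
  have := congrFun hc i
  rw [map_mul, map_sum, ← this, Finset.sum_apply, Finset.mul_sum]
  refine Finset.sum_congr rfl fun j _ => ?_
  rw [map_mul, ha, Pi.smul_apply, smul_eq_mul, Algebra.smul_def, mul_assoc]

end LinearAlgebra

section Presentation

open MvPolynomial

/-- A presentation of a finitely generated algebra adapted to an arc: the equations `f` have a
nonvanishing Jacobian determinant along the arc, and their differentials span those of all
relations. -/
theorem exists_adapted_presentation {k R : Type u} [Field k] [CommRing R] [Algebra k R]
    [Algebra.FiniteType k R] (γ₀ : R →ₐ[k] k⟦X⟧) :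
    ∃ (σ τ : Type) (_ : Fintype σ) (_ : Fintype τ) (_ : DecidableEq τ)
      (π : MvPolynomial (σ ⊕ τ) k →ₐ[k] R) (f : τ → MvPolynomial (σ ⊕ τ) k),
      Function.Surjective π ∧ (∀ j, π (f j) = 0) ∧ γ₀ (π (jac f).det) ≠ 0 ∧
        ∀ h, π h = 0 → ∃ (b : k⟦X⟧) (a : τ → k⟦X⟧), b ≠ 0 ∧
          ∀ i, b * γ₀ (π (pderiv i h)) = ∑ j, a j * γ₀ (π (pderiv i (f j))) := by
  classical
  obtain ⟨n, π, hπ⟩ := Algebra.FiniteType.iff_quotient_mvPolynomial''.1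
    (inferInstance : Algebra.FiniteType k R)
  let K := FractionRing k⟦X⟧
  let g : MvPolynomial (Fin n) k → Fin n → K := fun h i => algebraMap _ K (γ₀ (π (pderiv i h)))
  obtain ⟨τ, _, _, a, v, ha, hv, hdet, hspan⟩ :=
    exists_minor_ne_zero (g '' { h | π h = 0 })
  choose f₀ hf₀ hf₀v using hv
  let ε : {i // i ∉ Set.range a} ⊕ τ ≃ Fin n :=
    ((Equiv.sumComm _ _).trans (Equiv.sumCongr (Equiv.ofInjective a ha) (Equiv.refl _))).trans
      (Equiv.sumCompl (· ∈ Set.range a))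
  have hε : ∀ j, ε (Sum.inr j) = a j := fun j => rfl
  let π' : MvPolynomial ({i // i ∉ Set.range a} ⊕ τ) k →ₐ[k] R := π.comp (rename ε)
  have hπ' : ∀ p, π' (rename ε.symm p) = π p := by
    intro p
    change π (rename ε (rename ε.symm p)) = _
    rw [rename_rename, Equiv.self_comp_symm, rename_id_apply]
  have hder : ∀ (i : {i // i ∉ Set.range a} ⊕ τ) (p : MvPolynomial (Fin n) k),
      pderiv i (rename ε.symm p) = rename ε.symm (pderiv (ε i) p) := by
    intro i p
    rw [← pderiv_rename ε.symm.injective, Equiv.symm_apply_apply]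
  refine ⟨{i // i ∉ Set.range a}, τ, inferInstance, inferInstance, inferInstance, π',
    fun j => rename ε.symm (f₀ j), fun x => ?_, fun j => ?_, ?_, fun h hh => ?_⟩
  · obtain ⟨p, rfl⟩ := hπ x
    exact ⟨_, hπ' p⟩
  · rw [hπ']
    exact hf₀ j
  · intro h0
    apply hdet
    rw [← AlgHom.comp_apply, AlgHom.map_det] at h0
    rw [← map_zero (algebraMap k⟦X⟧ K), ← h0, RingHom.map_det]
    congr 1
    ext i j
    rw [Matrix.of_apply, ← hf₀v]
    change g (f₀ i) (a j) = algebraMap _ K (γ₀ (π' (pderiv (Sum.inr j) (rename ε.symm (f₀ i)))))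
    rw [hder, hπ', hε]
  · have hmem := hspan (Set.mem_image_of_mem g (x := rename ε h) hh)
    have hv' : v = fun j i => algebraMap _ K (γ₀ (π (pderiv i (f₀ j)))) := by
      funext j
      rw [← hf₀v]
    rw [hv'] at hmem
    obtain ⟨b, c, hb, hc⟩ := exists_smul_eq_sum_of_mem_span hmem
    refine ⟨b, c, hb, fun i => ?_⟩
    have h1 := hc (ε i)
    rw [pderiv_rename ε.injective] at h1
    refine h1.trans (Finset.sum_congr rfl fun j _ => ?_)
    rw [hder, hπ']

end Presentation


/-! ### Deformations satisfying the adapted equations stay on the scheme. -/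

section Deformation

open MvPolynomial

variable {k R : Type u} [Field k] [CommRing R] [Algebra k R]

theorem FractionRing.isUnit_algebraMap_of_redSeries_ne_zero {k : Type u} [Field k]
    {A : TestRing k} {p : A⟦X⟧} (h : A.redSeries p ≠ 0) :
    IsUnit (algebraMap A⟦X⟧ (FractionRing A⟦X⟧) p) :=
  IsLocalization.map_units (M := nonZeroDivisors A⟦X⟧) (FractionRing A⟦X⟧)
    ⟨p, A.mem_nonZeroDivisors_of_redSeries_ne_zero h⟩

/-- The lift of an arc of a smooth open subset to a first-order neighbourhood. -/
theorem exists_formallySmooth_lift {ι : Type} {π : MvPolynomial ι k →ₐ[k] R}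
    (hπ : Function.Surjective π) {g : R} [Algebra.FormallySmooth k (Localization.Away g)]
    {L : Type u} [CommRing L] [Algebra k L] (c : ι → L) {M : Ideal L} (hM : IsNilpotent M)
    (hker : ∀ h, π h = 0 → aeval c h ∈ M) (hg : ∀ p, π p = g → IsUnit (aeval c p)) :
    ∃ c' : ι → L, (∀ i, c' i - c i ∈ M) ∧ ∀ h, π h = 0 → aeval c' h = 0 := by
  let ρ : (MvPolynomial ι k ⧸ RingHom.ker π) →ₐ[k] L ⧸ M := Ideal.Quotient.liftₐ (RingHom.ker π)
    ((Ideal.Quotient.mkₐ k M).comp (aeval c)) fun h hh =>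
      Ideal.Quotient.eq_zero_iff_mem.2 (hker h hh)
  let ψ : R →ₐ[k] L ⧸ M := ρ.comp
    (Ideal.quotientKerAlgEquivOfSurjective hπ).symm.toAlgHom
  have hψ : ∀ p, ψ (π p) = Ideal.Quotient.mkₐ k M (aeval c p) := by
    intro p
    have h1 : (Ideal.quotientKerAlgEquivOfSurjective hπ).symm (π p) =
        Ideal.Quotient.mk (RingHom.ker π) p := by
      rw [AlgEquiv.symm_apply_eq]
      rfl
    change ρ ((Ideal.quotientKerAlgEquivOfSurjective hπ).symm (π p)) = _
    rw [h1]
    rfl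
  have hunit : ∀ y : Submonoid.powers g, IsUnit (ψ y) := by
    rintro ⟨_, m, rfl⟩
    obtain ⟨p, hp⟩ := hπ g
    rw [map_pow, ← hp, hψ]
    exact ((hg p hp).map _).pow m
  let ψ' : Localization.Away g →ₐ[k] L ⧸ M :=
    IsLocalization.liftAlgHom (M := Submonoid.powers g) (f := ψ) hunit
  obtain ⟨s, hs⟩ := Algebra.FormallySmooth.exists_lift M hM ψ'
  have hsc : ∀ p, aeval (fun i => s (algebraMap R _ (π (X i)))) p =
      s (algebraMap R _ (π p)) := by
    intro p
    have : (aeval fun i => s (algebraMap R _ (π (X i)))) =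
        (s.comp (IsScalarTower.toAlgHom k R (Localization.Away g))).comp π := by
      ext i
      simp
    rw [this]
    rfl
  refine ⟨fun i => s (algebraMap R _ (π (X i))), fun i => ?_, fun h hh => ?_⟩
  · rw [← Ideal.Quotient.mk_eq_mk_iff_sub_mem]
    have h1 := AlgHom.congr_fun hs (algebraMap R _ (π (X i)))
    have h2 : ψ' (algebraMap R _ (π (X i))) = ψ (π (X i)) := IsLocalization.lift_eq _ _
    rw [h2, hψ, aeval_X] at h1
    exact h1
  · rw [hsc, hh, map_zero, map_zero]

/-- Modulo `N * M` one has `b * x ≡ -∑ b * P i * δ i ≡ -∑ a l * Q l i * δ i ≡ 0`. In the application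
`x` is the value of a relation, `P` its gradient, the `Q l` are the gradients of the chosen
equations, and `δ` is the displacement to a genuine point of the scheme. -/
theorem mul_mem_mul_of_linear_relation {L ι τ : Type*} [CommRing L] [Fintype ι] [Fintype τ]
    {N M : Ideal L} (b x : L) (a : τ → L) {P δ : ι → L} {Q : τ → ι → L}
    (hδ : ∀ i, δ i ∈ M) (hdiff : ∀ i, b * P i - ∑ l, a l * Q l i ∈ N)
    (hx : x + ∑ i, P i * δ i ∈ N * M) (hQ : ∀ l, ∑ i, Q l i * δ i ∈ N * M) :
    b * x ∈ N * M := by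
  have h1 : ∑ i, (b * P i - ∑ l, a l * Q l i) * δ i ∈ N * M :=
    Ideal.sum_mem _ fun i _ => Ideal.mul_mem_mul (hdiff i) (hδ i)
  have h2 : ∑ l, a l * ∑ i, Q l i * δ i ∈ N * M :=
    Ideal.sum_mem _ fun l _ => Ideal.mul_mem_left _ _ (hQ l)
  have h3 : ∑ i, (b * P i - ∑ l, a l * Q l i) * δ i =
      b * ∑ i, P i * δ i - ∑ l, a l * ∑ i, Q l i * δ i := by
    simp only [sub_mul, Finset.sum_sub_distrib, Finset.sum_mul, Finset.mul_sum, mul_assoc]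
    rw [Finset.sum_comm]
  convert Ideal.sub_mem _ (Ideal.sub_mem _ (Ideal.mul_mem_left _ b hx) h1) h2 using 1
  rw [h3]
  ring

/-- Deformations of an arc satisfying the equations of an adapted presentation satisfy all
relations. -/
theorem aeval_eq_zero_of_adapted {σ τ : Type} [Fintype σ] [Fintype τ]
    {π : MvPolynomial (σ ⊕ τ) k →ₐ[k] R} (hπ : Function.Surjective π) (γ₀ : R →ₐ[k] k⟦X⟧)
    {f : τ → MvPolynomial (σ ⊕ τ) k}
    (hspan : ∀ h, π h = 0 → ∃ (b : k⟦X⟧) (a : τ → k⟦X⟧), b ≠ 0 ∧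
      ∀ i, b * γ₀ (π (pderiv i h)) = ∑ j, a j * γ₀ (π (pderiv i (f j))))
    {g : R} (hg : γ₀ g ≠ 0) [Algebra.FormallySmooth k (Localization.Away g)]
    (hf : ∀ j, π (f j) = 0) {A : TestRing k} {c : σ ⊕ τ → A⟦X⟧}
    (hc : ∀ i, A.redSeries (c i) = γ₀ (π (X i))) (hcf : ∀ j, aeval c (f j) = 0)
    (h : MvPolynomial (σ ⊕ τ) k) (hh : π h = 0) : aeval c h = 0 := by
  let L := FractionRing A⟦X⟧
  let j : A⟦X⟧ →ₐ[k] L := IsScalarTower.toAlgHom k A⟦X⟧ L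
  have hj : ∀ p, aeval (fun i => j (c i)) p = j (aeval c p) := fun p =>
    (comp_aeval_apply c j p).symm
  have hred : ∀ p, A.redSeries (aeval c p) = γ₀ (π p) := by
    intro p
    rw [redSeries_aeval hc, ← AlgHom.comp_apply]
    congr 1
    ext i
    simp
  let N : Ideal L := (RingHom.ker A.redSeries).map j
  have hjN : ∀ p, A.redSeries p = 0 → j p ∈ N := fun p hp => Ideal.mem_map_of_mem j hp
  have hN : IsNilpotent N := by
    obtain ⟨m, hm⟩ := A.isNilpotent_ker_redSeries
    refine ⟨m, ?_⟩
    rw [← Ideal.map_pow, hm, Ideal.zero_eq_bot, Ideal.map_bot, Ideal.zero_eq_bot]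
  let M : Ideal L := Ideal.span ((fun p => j (aeval c p)) '' { p | π p = 0 })
  have hMmem : ∀ p, π p = 0 → j (aeval c p) ∈ M := fun p hp =>
    Ideal.subset_span ⟨p, hp, rfl⟩
  have hMN : M ≤ N := Ideal.span_le.2 (by
    rintro _ ⟨p, hp, rfl⟩
    exact hjN _ (by rw [hred, hp, map_zero]))
  have hMnil : IsNilpotent M := by
    obtain ⟨m, hm⟩ := hN
    refine ⟨m, ?_⟩
    rw [Ideal.zero_eq_bot, eq_bot_iff, ← Ideal.zero_eq_bot, ← hm]
    exact Ideal.pow_right_mono hMN m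
  -- Modulo `M` the vector `c` is a point of the scheme, lying where `g` is invertible. Formal
  -- smoothness lifts it to a point `c'` over `L`, congruent to `c` modulo `M`.
  obtain ⟨c', hc'M, hc'⟩ := exists_formallySmooth_lift hπ (g := g) (fun i => j (c i)) hMnil
    (fun p hp => by rw [hj]; exact hMmem p hp) (fun p hp => by
      rw [hj]
      exact FractionRing.isUnit_algebraMap_of_redSeries_ne_zero (by rwa [hred, hp]))
  have htaylor : ∀ p, π p = 0 →
      j (aeval c p) + ∑ i, j (aeval c (pderiv i p)) * (c' i - j (c i)) ∈ M ^ 2 := by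
    intro p hp
    have := aeval_taylor_mem M hc'M p
    rw [hc' p hp] at this
    simp only [hj] at this
    rw [← neg_mem_iff]
    convert this using 1
    ring
  have hM2 : M ^ 2 ≤ N * M := by
    rw [pow_two]
    exact Ideal.mul_mono_left hMN
  -- The linear dependence of the gradients holds exactly along `γ₀` and so only modulo `N` along
  -- `c`; its denominator `b` becomes a unit in `L`.
  have hMNM : M ≤ N * M := by
    refine Ideal.span_le.2 ?_
    rintro _ ⟨p, hp, rfl⟩
    obtain ⟨b, a, hb, hab⟩ := hspan p hp
    have hbu : IsUnit (j (A.liftSeries b)) :=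
      FractionRing.isUnit_algebraMap_of_redSeries_ne_zero (by rwa [A.redSeries_liftSeries])
    have hdiff : ∀ i, j (A.liftSeries b) * j (aeval c (pderiv i p)) -
        ∑ l, j (A.liftSeries (a l)) * j (aeval c (pderiv i (f l))) ∈ N := by
      intro i
      simp only [← map_mul, ← map_sum, ← map_sub]
      apply hjN
      rw [map_sub, map_mul, map_sum, A.redSeries_liftSeries, hred, hab, sub_eq_zero]
      refine Finset.sum_congr rfl fun l _ => ?_
      rw [map_mul, A.redSeries_liftSeries, hred]
    have h4 : j (A.liftSeries b) * j (aeval c p) ∈ N * M :=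
      mul_mem_mul_of_linear_relation _ _ (fun l => j (A.liftSeries (a l))) hc'M hdiff
        (hM2 (htaylor p hp)) fun l => by
          have := hM2 (htaylor _ (hf l))
          rwa [hcf, map_zero, zero_add] at this
    obtain ⟨u, hu⟩ := hbu
    rw [← hu] at h4
    have h6 := Ideal.mul_mem_left _ (u⁻¹).1 h4
    rwa [Units.inv_mul_cancel_left] at h6
  have hMpow : ∀ m : ℕ, M ≤ N ^ m * M := by
    intro m
    induction m with
    | zero => simp
    | succ m ih =>
      refine ih.trans ?_
      rw [pow_succ, mul_assoc]
      exact Ideal.mul_mono_right hMNM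
  obtain ⟨m, hm⟩ := hN
  have h0 := hMpow m (hMmem h hh)
  rw [hm, Ideal.zero_eq_bot, Ideal.bot_mul, Ideal.mem_bot] at h0
  exact IsFractionRing.injective A⟦X⟧ L (h0.trans (map_zero _).symm)

end Deformation


/-! ### Without free variables the arc is constant and its origin is isolated. -/

section Isolated

open MvPolynomial

variable {k : Type u} [Field k]

/-- A nonzero series over a field is a power of the variable times a unit, and both factors stay
non-zero-divisors over any `A`. -/
theorem PowerSeries.algebraMap_mem_nonZeroDivisors {A : Type u} [CommRing A] [Algebra k A]
    {p : k⟦X⟧} (hp : p ≠ 0) :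
    PowerSeries.mapAlgHom (Algebra.ofId k A) p ∈ nonZeroDivisors A⟦X⟧ := by
  obtain ⟨n, v, hv, rfl⟩ : ∃ (n : ℕ) (v : k⟦X⟧), IsUnit v ∧ p = PowerSeries.X ^ n * v := by
    refine ⟨p.order.toNat, PowerSeries.divXPowOrder p, ?_,
      (PowerSeries.X_pow_order_mul_divXPowOrder (f := p)).symm⟩
    rw [PowerSeries.isUnit_iff_constantCoeff, isUnit_iff_ne_zero,
      PowerSeries.constantCoeff_divXPowOrder]
    exact PowerSeries.coeff_order hp
  rw [map_mul]
  refine mul_mem ?_ (hv.map _).mem_nonZeroDivisors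
  have h1 : PowerSeries.mapAlgHom (Algebra.ofId k A) (PowerSeries.X ^ n : k⟦X⟧) =
      PowerSeries.X ^ n := by
    rw [PowerSeries.mapAlgHom_apply, map_pow, PowerSeries.map_X]
  rw [h1]
  refine pow_mem ?_ n
  rw [mem_nonZeroDivisors_iff_right]
  intro x hx
  ext i
  have := congrArg (PowerSeries.coeff (i + 1)) hx
  simpa using this

/-- An arc at which a square system of equations has nonvanishing Jacobian determinant is invariant
under rescaling of the parameter. -/
theorem rescale_eq_of_jac_ne_zero {A : Type u} [CommRing A] [Algebra k A] {w : A}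
    (hw : IsNilpotent w) {σ τ : Type} [Fintype σ] [IsEmpty σ] [Fintype τ] [DecidableEq τ]
    {f : τ → MvPolynomial (σ ⊕ τ) k} {c₀ : σ ⊕ τ → k⟦X⟧} (hf : ∀ j, aeval c₀ (f j) = 0)
    (hdet : aeval c₀ (jac f).det ≠ 0) (i : τ) :
    PowerSeries.rescale (1 + w) (PowerSeries.mapAlgHom (Algebra.ofId k A) (c₀ (Sum.inr i))) =
      PowerSeries.mapAlgHom (Algebra.ofId k A) (c₀ (Sum.inr i)) := by
  let L := FractionRing A⟦X⟧
  let j : A⟦X⟧ →ₐ[k] L := IsScalarTower.toAlgHom k A⟦X⟧ L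
  let c : σ ⊕ τ → A⟦X⟧ := fun i => PowerSeries.mapAlgHom (Algebra.ofId k A) (c₀ i)
  let ρ : A⟦X⟧ →ₐ[k] A⟦X⟧ := (PowerSeries.rescaleAlgHom (1 + w)).restrictScalars k
  have hc : ∀ p, aeval c p = PowerSeries.mapAlgHom (Algebra.ofId k A) (aeval c₀ p) := fun p =>
    (comp_aeval_apply c₀ (PowerSeries.mapAlgHom (Algebra.ofId k A)) p).symm
  have hj : ∀ p, aeval (fun i => j (c i)) p = j (aeval c p) := fun p =>
    (comp_aeval_apply c j p).symm
  have hjρ : ∀ p, aeval (fun i => j (ρ (c i))) p = j (ρ (aeval c p)) := fun p =>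
    (comp_aeval_apply c (j.comp ρ) p).symm
  have hρr : ∀ p, ρ p = PowerSeries.rescale (1 + w) p := fun p => by
    change PowerSeries.rescaleAlgHom (1 + w) p = _
    rw [← PowerSeries.coe_rescaleAlgHom]
    rfl
  have hρ : ∀ p, ρ p - p ∈ Ideal.span {PowerSeries.C w} := by
    intro p
    rw [Ideal.mem_span_singleton, hρr]
    -- Rescaling multiplies the `n`-th coefficient by `(1 + w) ^ n`, which is congruent to `1`
    -- modulo `w`.
    choose s hs using fun n : ℕ => (sub_dvd_pow_sub_pow (1 + w) 1 n)
    refine ⟨PowerSeries.mk fun n => s n * PowerSeries.coeff n p, ?_⟩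
    ext n
    have := hs n
    rw [one_pow, add_sub_cancel_left] at this
    simp only [map_sub, PowerSeries.coeff_C_mul, PowerSeries.coeff_mk, PowerSeries.coeff_rescale]
    rw [← mul_assoc, ← this]
    ring
  have hI : IsNilpotent ((Ideal.span {PowerSeries.C w}).map j) := by
    obtain ⟨m, hm⟩ := hw
    refine ⟨m, ?_⟩
    rw [← Ideal.map_pow, Ideal.span_singleton_pow, ← map_pow, hm, map_zero,
      Ideal.span_singleton_zero, Ideal.map_bot, Ideal.zero_eq_bot]
  have hunit : IsUnit (j (aeval c (jac f).det)) := by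
    rw [hc]
    exact IsLocalization.map_units (M := nonZeroDivisors A⟦X⟧) L
      ⟨_, PowerSeries.algebraMap_mem_nonZeroDivisors hdet⟩
  -- In the total fraction ring the determinant is a unit, so `q = 1` is admissible. The arc and its
  -- rescaling are solutions congruent modulo the nilpotent `w`, hence equal.
  have h0 := eq_of_newton f (c := fun i => j (c i)) (c' := fun i => j (ρ (c i))) (q := 1)
    (r := 1) le_rfl hI (one_mem _) hunit (by rw [hj, one_mul]) (fun i => isEmptyElim i)
    (ζ := fun l => j (ρ (c (Sum.inr l))) - j (c (Sum.inr l)))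
    (fun l => by
      rw [← map_sub]
      exact Ideal.mem_map_of_mem j (hρ _))
    (fun l => by rw [one_pow, one_mul])
    (fun l => by rw [hj, hc, hf, map_zero, map_zero])
    (fun l => by rw [hjρ, hc, hf, map_zero, map_zero, map_zero])
  rw [← hρr]
  exact IsFractionRing.injective A⟦X⟧ L (sub_eq_zero.1 (congrFun h0 i))

/-- An arc at which a square system of equations has nonvanishing Jacobian determinant is
constant. -/
theorem eq_const_of_jac_ne_zero {σ τ : Type} [Fintype σ] [IsEmpty σ] [Fintype τ] [DecidableEq τ]
    {f : τ → MvPolynomial (σ ⊕ τ) k} {c₀ : σ ⊕ τ → k⟦X⟧} (hf : ∀ j, aeval c₀ (f j) = 0)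
    (hdet : aeval c₀ (jac f).det ≠ 0) (i : σ ⊕ τ) :
    c₀ i = algebraMap k k⟦X⟧ (PowerSeries.constantCoeff (c₀ i)) := by
  rcases i with i | i
  · exact isEmptyElim i
  ext m
  rcases Nat.eq_zero_or_pos m with rfl | hm
  · simp
  rw [PowerSeries.algebraMap_apply, PowerSeries.coeff_C, if_neg hm.ne']
  by_contra hne
  -- The ring `k[w]/(w^(m+1))` retains the term `w^m` of `(1 + w)^m - 1`. Its coefficient is `1` in
  -- every characteristic, so invariance forces the `m`-th coefficient of the arc to vanish; the
  -- linear term `m * w` would not suffice.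
  have hw : IsNilpotent (Ideal.Quotient.mk (Ideal.span {(Polynomial.X : k[X]) ^ (m + 1)})
      Polynomial.X) := by
    refine ⟨m + 1, ?_⟩
    rw [← map_pow]
    exact Ideal.Quotient.eq_zero_iff_mem.2 (Ideal.mem_span_singleton_self _)
  have h2 := congrArg (PowerSeries.coeff m) (rescale_eq_of_jac_ne_zero hw hf hdet i)
  rw [PowerSeries.coeff_rescale, PowerSeries.mapAlgHom_apply, PowerSeries.coeff_map] at h2
  have hu : IsUnit ((Algebra.ofId k (k[X] ⧸ Ideal.span {(Polynomial.X : k[X]) ^ (m + 1)}))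
      (PowerSeries.coeff m (c₀ (Sum.inr i)))) :=
    (IsUnit.mk0 _ hne).map _
  have h3 := hu.mul_right_cancel (h2.trans (one_mul _).symm)
  have h4 : ((1 + Polynomial.X) ^ m - 1 : k[X]) ∈
      Ideal.span {(Polynomial.X : k[X]) ^ (m + 1)} := by
    rw [← Ideal.Quotient.eq_zero_iff_mem, map_sub, map_pow, map_add, map_one, sub_eq_zero]
    exact h3
  rw [Ideal.mem_span_singleton, Polynomial.X_pow_dvd_iff] at h4
  have h5 := h4 m (Nat.lt_succ_self m)
  rw [Polynomial.coeff_sub, Polynomial.coeff_one_add_X_pow, Nat.choose_self,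
    Polynomial.coeff_one, if_neg hm.ne'] at h5
  simp at h5

/-- If a square system of relations has nonvanishing Jacobian determinant along an arc, then the
origin of the arc is an isolated point. -/
theorem isOpen_singleton_of_jac_ne_zero {R : Type u} [CommRing R] [Algebra k R] {σ τ : Type}
    [Fintype σ] [IsEmpty σ] [Fintype τ] [DecidableEq τ] {π : MvPolynomial (σ ⊕ τ) k →ₐ[k] R}
    (hπ : Function.Surjective π) (γ₀ : R →ₐ[k] k⟦X⟧) {f : τ → MvPolynomial (σ ⊕ τ) k}
    (hf : ∀ j, π (f j) = 0) (hdet : γ₀ (π (jac f).det) ≠ 0) :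
    IsOpen {(⟨(IsLocalRing.maximalIdeal k⟦X⟧).comap γ₀, inferInstance⟩ : PrimeSpectrum R)} := by
  have hγ : ∀ p, γ₀ (π p) = aeval (fun i => γ₀ (π (X i))) p := by
    intro p
    rw [← AlgHom.comp_apply]
    congr 1
    ext i
    simp
  set a : σ ⊕ τ → k := fun i => PowerSeries.constantCoeff (γ₀ (π (X i))) with ha
  have hconst : ∀ i, γ₀ (π (X i)) = algebraMap k k⟦X⟧ (a i) :=
    eq_const_of_jac_ne_zero (f := f) (fun j => by rw [← hγ, hf, map_zero]) (by rwa [← hγ])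
  have hγa : ∀ p, γ₀ (π p) = algebraMap k k⟦X⟧ (aeval a p) := by
    intro p
    rw [hγ, funext hconst]
    exact aeval_algebraMap_apply k⟦X⟧ a p
  set I : Ideal R := (IsLocalRing.maximalIdeal k⟦X⟧).comap γ₀ with hI
  have hmem : ∀ p, π p ∈ I ↔ aeval a p = 0 := by
    intro p
    rw [hI, Ideal.mem_comap, hγa, IsLocalRing.mem_maximalIdeal, mem_nonunits_iff,
      PowerSeries.isUnit_iff_constantCoeff, isUnit_iff_ne_zero, not_not]
    simp
  have hpi : ∀ p, π p = aeval (fun i => π (X i)) p := by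
    intro p
    congr 1
    ext i
    simp
  have hfa : ∀ j, aeval a (f j) = 0 := fun j => (hmem _).1 (by rw [hf]; exact I.zero_mem)
  have hdeta : aeval a (jac f).det ≠ 0 := by
    intro h
    rw [hγa, h, map_zero] at hdet
    exact hdet rfl
  have hsub : ∀ i, π (X i) - algebraMap k R (a i) ∈ I := by
    intro i
    have : π (X i) - algebraMap k R (a i) = π (X i - C (a i)) := by
      rw [map_sub]
      congr 1
      exact (π.commutes _).symm
    rw [this, hmem]
    simp
  have halg : ∀ p : MvPolynomial (σ ⊕ τ) k,
      aeval (fun i => algebraMap k R (a i)) p = algebraMap k R (aeval a p) := fun p =>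
    aeval_algebraMap_apply R a p
  -- Both the coordinate vector of `R` and the constant vector `a` are zeros of `f`, and they agree
  -- modulo `I`. The determinant is a unit at `a`, so the expansion of `adjMul f` puts the
  -- difference into `I ^ 2`.
  have hsub2 : ∀ i, π (X i) - algebraMap k R (a i) ∈ I ^ 2 := by
    rintro (i | i)
    · exact isEmptyElim i
    have h1 := aeval_adjMul_sub_mem f (c := fun i => algebraMap k R (a i))
      (c' := fun i => π (X i)) (fun i => isEmptyElim i) (I := I) (K := ⊥) (fun i => hsub _)
      (fun j => by rw [halg, hfa, map_zero]; exact Ideal.zero_mem _) i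
    rw [adjMul_eq_zero f (fun j => by rw [← hpi, hf]), adjMul_eq_zero f (fun j => by
      rw [halg, hfa, map_zero]), Ideal.mul_bot, bot_sup_eq, sub_zero, zero_sub, neg_mem_iff,
      halg] at h1
    obtain ⟨u, hu⟩ := (IsUnit.mk0 _ hdeta).map (algebraMap k R)
    rw [← hu] at h1
    have h2 := Ideal.mul_mem_left _ (u⁻¹).1 h1
    rwa [Units.inv_mul_cancel_left] at h2
  -- Every element of `I` is a polynomial in the coordinates that vanishes at `a`, so `I = I ^ 2`.
  -- In a noetherian ring such an ideal is generated by an idempotent `e`, and its point is the open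
  -- set where `1 - e` is invertible.
  have hidem : IsIdempotentElem I := by
    refine le_antisymm Ideal.mul_le_left fun x hx => ?_
    obtain ⟨p, rfl⟩ := hπ x
    have h1 := aeval_sub_aeval_mem (I ^ 2) hsub2 p
    rwa [halg, (hmem p).1 hx, map_zero, sub_zero, ← hpi, pow_two] at h1
  have : IsNoetherianRing R := isNoetherianRing_of_surjective _ R π.toRingHom hπ
  obtain ⟨e, he, hIe⟩ := (Ideal.isIdempotentElem_iff_of_fg I (IsNoetherian.noetherian I)).1 hidem
  have heI : e ∈ I := by rw [hIe]; exact Ideal.mem_span_singleton_self e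
  have hmax : I.IsMaximal := by
    rw [Ideal.isMaximal_iff]
    refine ⟨fun h => ?_, fun J x hJ hx hxJ => ?_⟩
    · rw [← map_one π, hmem, map_one] at h
      exact one_ne_zero h
    · obtain ⟨p, rfl⟩ := hπ x
      have hne : aeval a p ≠ 0 := fun h => hx ((hmem p).2 h)
      have h1 := aeval_sub_aeval_mem I hsub p
      rw [halg, ← hpi] at h1
      have h2 := J.sub_mem hxJ (hJ h1)
      rw [sub_sub_cancel] at h2
      obtain ⟨u, hu⟩ := (IsUnit.mk0 _ hne).map (algebraMap k R)
      rw [← hu] at h2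
      have h3 := J.mul_mem_left (u⁻¹).1 h2
      rwa [Units.inv_mul] at h3
  have : ({⟨I, inferInstance⟩} : Set (PrimeSpectrum R)) = PrimeSpectrum.basicOpen (1 - e) := by
    ext x
    rw [Set.mem_singleton_iff, SetLike.mem_coe, PrimeSpectrum.mem_basicOpen]
    constructor
    · rintro rfl h
      have : (1 : R) ∈ I := by simpa using I.add_mem h heI
      exact hmax.ne_top ((Ideal.eq_top_iff_one _).2 this)
    · intro h
      have h1 : e ∈ x.asIdeal := by
        have h2 : e * (1 - e) ∈ x.asIdeal := by
          rw [mul_sub, mul_one, he.eq, sub_self]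
          exact x.asIdeal.zero_mem
        exact (x.isPrime.mem_or_mem h2).resolve_right h
      refine PrimeSpectrum.ext (hmax.eq_of_le x.isPrime.ne_top ?_).symm
      rw [hIe]
      exact (Ideal.span_singleton_le_iff_mem _).2 h1
  rw [this]
  exact PrimeSpectrum.isOpen_basicOpen

end Isolated


/-! ### The theorem for affine schemes. -/

section AffineArcs

open MvPolynomial

variable {k : Type u} [Field k]

/-- The formal neighbourhood of an arc of an affine scheme, in terms of algebras. -/
def affineArcNbhd {R : Type u} [CommRing R] [Algebra k R] (γ₀ : R →ₐ[k] k⟦X⟧) :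
    TestRing k ⥤ Type u :=
  TestRing.typeFunctor (fun A => { φ : R →ₐ[k] A⟦X⟧ // A.redSeries.comp φ = γ₀ })
    (fun {A A'} f φ => ⟨(PowerSeries.mapAlgHom f).comp φ.1, by
      refine AlgHom.ext fun x => ?_
      exact (TestRing.redSeries_mapAlgHom _ _).trans (AlgHom.congr_fun φ.2 x)⟩)
    (fun A φ => Subtype.ext (by
      change (PowerSeries.mapAlgHom (AlgHom.id k A)).comp φ.1 = _
      rw [_root_.mapAlgHom_id, AlgHom.id_comp]))
    (fun A B C f g φ => Subtype.ext (by
      change (PowerSeries.mapAlgHom (AlgHom.comp g f)).comp φ.1 = _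
      rw [_root_.mapAlgHom_comp]
      rfl))

/-- The arcs of an affine scheme near a given generically smooth arc are cut out by any system of
equations which is adapted to the given arc. -/
theorem nonempty_affineArcNbhd_iso_arcPoints {R : Type u} [CommRing R] [Algebra k R]
    {σ τ : Type} [Fintype σ] [Fintype τ]
    [DecidableEq τ] {π : MvPolynomial (σ ⊕ τ) k →ₐ[k] R} (hπ : Function.Surjective π)
    (γ₀ : R →ₐ[k] k⟦X⟧) {f : τ → MvPolynomial (σ ⊕ τ) k} (hf : ∀ j, π (f j) = 0)
    (hspan : ∀ h, π h = 0 → ∃ (b : k⟦X⟧) (a : τ → k⟦X⟧), b ≠ 0 ∧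
      ∀ i, b * γ₀ (π (pderiv i h)) = ∑ j, a j * γ₀ (π (pderiv i (f j))))
    {g : R} (hg : γ₀ g ≠ 0) [Algebra.FormallySmooth k (Localization.Away g)] :
    Nonempty (affineArcNbhd γ₀ ≅ arcPoints f fun i => γ₀ (π (X i))) := by
  have hφ : ∀ {A : TestRing k} (φ : R →ₐ[k] A⟦X⟧),
      (aeval fun i => φ (π (X i))) = φ.comp π := by
    intro A φ
    ext i
    simp
  refine nonempty_iso_of_bijective (fun A φ => ⟨fun i => φ.1 (π (X i)), fun j => ?_,
    fun i => AlgHom.congr_fun φ.2 _⟩) (fun _ _ _ _ => rfl) fun A => ⟨fun φ ψ h => ?_, ?_⟩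
  · rw [hφ, AlgHom.comp_apply, hf, map_zero]
  · refine Subtype.ext (AlgHom.ext fun x => ?_)
    obtain ⟨p, rfl⟩ := hπ x
    have h1 := congrArg (fun c => aeval c p) (Subtype.ext_iff.1 h)
    dsimp only at h1
    rw [hφ, hφ] at h1
    exact h1
  · rintro ⟨c, hcf, hc⟩
    have hker : ∀ h : MvPolynomial (σ ⊕ τ) k, h ∈ RingHom.ker π.toRingHom → aeval c h = 0 :=
      fun h hh => aeval_eq_zero_of_adapted hπ γ₀ hspan hg hf hc hcf h hh
    let φ : R →ₐ[k] A⟦X⟧ := (Ideal.Quotient.liftₐ (RingHom.ker π) (aeval c) hker).comp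
      (Ideal.quotientKerAlgEquivOfSurjective hπ).symm.toAlgHom
    have hφc : ∀ p, φ (π p) = aeval c p := by
      intro p
      have h1 : (Ideal.quotientKerAlgEquivOfSurjective hπ).symm (π p) =
          Ideal.Quotient.mk (RingHom.ker π) p := by
        rw [AlgEquiv.symm_apply_eq]
        rfl
      change Ideal.Quotient.liftₐ (RingHom.ker π) (aeval c) hker
        ((Ideal.quotientKerAlgEquivOfSurjective hπ).symm (π p)) = _
      rw [h1]
      rfl
    refine ⟨⟨φ, ?_⟩, Subtype.ext (funext fun i => (hφc _).trans (aeval_X _ _))⟩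
    have h2 : (A.redSeries.comp φ).comp π = γ₀.comp π := by
      ext1 i
      change A.redSeries (φ (π (X i))) = γ₀ (π (X i))
      rw [hφc, aeval_X, hc]
    refine AlgHom.ext fun x => ?_
    obtain ⟨p, rfl⟩ := hπ x
    exact AlgHom.congr_fun h2 p

/-- The formal arc theorem for affine schemes. -/
theorem affine_formal_arc_theorem {R : Type u} [CommRing R] [Algebra k R]
    [Algebra.FiniteType k R] (γ₀ : R →ₐ[k] k⟦X⟧) {g : R} (hg : γ₀ g ≠ 0)
    [Algebra.FormallySmooth k (Localization.Away g)]
    (hiso : ¬ IsOpen {(⟨(IsLocalRing.maximalIdeal k⟦X⟧).comap γ₀, inferInstance⟩ :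
      PrimeSpectrum R)}) :
    ∃ (B : Type u) (_ : CommRing B) (_ : Algebra k B) (b : B →ₐ[k] k),
      Algebra.FiniteType k B ∧ Nonempty (affineArcNbhd γ₀ ≅
        FunctorToTypes.prod (formalNbhd (specStr k B) (specMap b)) (formalDiscPow k)) := by
  obtain ⟨σ, τ, _, _, _, π, f, hπ, hf, hdet, hspan⟩ := exists_adapted_presentation γ₀
  have : Nonempty σ := by
    by_contra hσ
    rw [not_nonempty_iff] at hσ
    exact hiso (isOpen_singleton_of_jac_ne_zero hπ γ₀ hf hdet)
  have hγ : ∀ p, aeval (fun i => γ₀ (π (X i))) p = γ₀ (π p) := by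
    intro p
    rw [← AlgHom.comp_apply]
    congr 1
    ext i
    simp
  have hf' : ∀ j, aeval (fun i => γ₀ (π (X i))) (f j) = 0 := fun j => by
    rw [hγ, hf, map_zero]
  obtain ⟨d, hd⟩ := ENat.ne_top_iff_exists.1
    (PowerSeries.order_eq_top.not.2 (by rwa [hγ]) :
      (aeval (fun i => γ₀ (π (X i))) (jac f).det).order ≠ ⊤)
  -- Here `le_rfl` fixes `r = 1`, the least precision for which Newton's method converges.
  obtain ⟨S₀, hq, hz⟩ := exists_congSol f le_rfl hf' hd.symm
  have hS₀ : CongSol.homEquiv (CongSol.homEquiv.symm S₀) = S₀ :=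
    CongSol.homEquiv.apply_symm_apply S₀
  refine ⟨_, inferInstance, inferInstance, CongSol.homEquiv.symm S₀,
    CongSol.finiteType_algebra, ?_⟩
  obtain ⟨α⟩ := nonempty_affineArcNbhd_iso_arcPoints hπ γ₀ hf hspan hg
  obtain ⟨β⟩ := nonempty_arcPoints_iso le_rfl hf' hd.symm hq hz
  obtain ⟨γ⟩ := CongSol.nonempty_affineNbhd_iso_nbhd (CongSol.homEquiv.symm S₀)
  obtain ⟨δ⟩ := nonempty_formalNbhd_iso_affineNbhd (CongSol.homEquiv.symm S₀)
  rw [hS₀] at γ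
  obtain ⟨ε⟩ := nonempty_prod_iso (γ.symm ≪≫ δ) (formalDiscPow k)
  exact ⟨α ≪≫ β ≪≫ ε⟩

end AffineArcs


/-! ### Passage from affine charts to schemes. -/

section SchemeArcs

variable {k : Type u} [Field k]

/-- The reduction is surjective with nilpotent kernel. Hence a deformation of an arc has the same
set-theoretic image as the arc and factors through the same open subschemes. -/
theorem TestRing.surjective_specMap_redSeries (A : TestRing k) :
    Function.Surjective (specMap A.redSeries) := by
  intro x
  have h1 : Function.Surjective (A.redSeries : A⟦X⟧ →+* k⟦X⟧) :=
    fun p => ⟨A.liftSeries p, A.redSeries_liftSeries p⟩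
  have h2 : x ∈ Set.range (PrimeSpectrum.comap (A.redSeries : A⟦X⟧ →+* k⟦X⟧)) := by
    rw [range_comap_of_surjective _ _ h1]
    intro p hp
    obtain ⟨n, hn⟩ := A.isNilpotent_ker_redSeries
    have h3 : p ^ n ∈ RingHom.ker A.redSeries ^ n := Ideal.pow_mem_pow hp n
    rw [hn, Ideal.zero_eq_bot, Ideal.mem_bot] at h3
    have h4 : p ^ n ∈ x.asIdeal := by
      rw [h3]
      exact Ideal.zero_mem _
    exact x.isPrime.mem_of_pow_mem n h4
  exact h2

/-- The formal neighbourhood of an arc only depends on an affine open subscheme containing the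
arc. -/
theorem nonempty_affineArcNbhd_iso_arcFormalNbhd {X : Scheme.{u}} (s : X ⟶ Spec (.of k))
    {R : Type u} [CommRing R] [Algebra k R] (j : Spec (.of R) ⟶ X) [IsOpenImmersion j]
    (hj : j ≫ s = specStr k R) (γ₀ : R →ₐ[k] k⟦X⟧) :
    Nonempty (affineArcNbhd γ₀ ≅ arcFormalNbhd s (specMap γ₀ ≫ j)) := by
  refine nonempty_iso_of_bijective (fun A φ => ⟨specMap φ.1 ≫ j, by
    rw [Category.assoc, hj, specMap_str], by
    rw [← Category.assoc, ← specMap_comp]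
    exact congrArg (fun ψ => specMap ψ ≫ j) φ.2⟩) ?_ ?_
  · intro A B f φ
    refine Subtype.ext ?_
    change specMap ((PowerSeries.mapAlgHom (TestRing.algHom f)).comp φ.1) ≫ j =
      specMap (PowerSeries.mapAlgHom (TestRing.algHom f)) ≫ specMap φ.1 ≫ j
    rw [specMap_comp, Category.assoc]
  · intro A
    constructor
    · intro φ ψ h
      have h1 : specMap φ.1 ≫ j = specMap ψ.1 ≫ j := Subtype.ext_iff.1 h
      exact Subtype.ext (specMap_injective ((cancel_mono j).1 h1))
    · rintro ⟨γ, hγ, hγ'⟩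
      have hrange : Set.range γ ⊆ Set.range j := by
        rintro _ ⟨x, rfl⟩
        obtain ⟨y, rfl⟩ := A.surjective_specMap_redSeries x
        refine ⟨specMap γ₀ y, ?_⟩
        rw [← Scheme.Hom.comp_apply, ← Scheme.Hom.comp_apply, ← hγ']
        rfl
      have hlift := IsOpenImmersion.lift_fac j γ hrange
      obtain ⟨φ, hφ⟩ := exists_specMap_eq (IsOpenImmersion.lift j γ hrange) (by
        rw [← hj, ← Category.assoc, hlift, hγ])
      rw [← hφ] at hlift
      refine ⟨⟨φ, specMap_injective ((cancel_mono j).1 ?_)⟩, Subtype.ext hlift⟩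
      rw [specMap_comp, Category.assoc, hlift]
      exact hγ'

/-- Smoothness on a neighbourhood restricts to a basic open subset of the chart contained in it, and
for affine schemes it is smoothness of the algebra. -/
theorem exists_formallySmooth_localization {X : Scheme.{u}} (s : X ⟶ Spec (.of k)) {R : Type u}
    [CommRing R] [Algebra k R] (j : Spec (.of R) ⟶ X) [IsOpenImmersion j]
    (hj : j ≫ s = specStr k R) {U : X.Opens} (hU : Smooth (U.ι ≫ s)) {x : Spec (.of R)}
    (hx : j x ∈ U) : ∃ g : R, g ∉ x.asIdeal ∧ Algebra.FormallySmooth k (Localization.Away g) := by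
  obtain ⟨_, ⟨_, ⟨g, rfl⟩, rfl⟩, hg, hgU⟩ :=
    PrimeSpectrum.isBasis_basic_opens.exists_subset_of_mem_open (show x ∈ (j ⁻¹ᵁ U : Set _) from hx)
      (j ⁻¹ᵁ U).isOpen
  refine ⟨g, hg, ?_⟩
  let ι : Spec (.of (Localization.Away g)) ⟶ Spec (.of R) :=
    specMap (IsScalarTower.toAlgHom k R (Localization.Away g))
  have : IsOpenImmersion ι :=
    inferInstanceAs (IsOpenImmersion (Spec.map (CommRingCat.ofHom
      (algebraMap R (Localization.Away g)))))
  have hrange : Set.range (ι ≫ j) ⊆ Set.range U.ι := by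
    rw [Scheme.Opens.range_ι]
    rintro _ ⟨y, rfl⟩
    have h1 : ι y ∈ Set.range (PrimeSpectrum.comap (algebraMap R (Localization.Away g))) :=
      ⟨y, rfl⟩
    rw [PrimeSpectrum.localization_away_comap_range (Localization.Away g) g] at h1
    exact hgU h1
  have hlift := IsOpenImmersion.lift_fac U.ι (ι ≫ j) hrange
  have : IsOpenImmersion (IsOpenImmersion.lift U.ι (ι ≫ j) hrange) := by
    have : IsOpenImmersion (IsOpenImmersion.lift U.ι (ι ≫ j) hrange ≫ U.ι) := by
      rw [hlift]
      infer_instance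
    exact IsOpenImmersion.of_comp _ U.ι
  have hs : Smooth (specStr k (Localization.Away g)) := by
    have h1 : specStr k (Localization.Away g) =
        IsOpenImmersion.lift U.ι (ι ≫ j) hrange ≫ U.ι ≫ s := by
      rw [← Category.assoc, hlift, Category.assoc, hj, specMap_str]
    rw [h1]
    infer_instance
  have h2 : (algebraMap k (Localization.Away g)).Smooth :=
    (HasRingHomProperty.Spec_iff (P := @Smooth)).1 hs
  rw [RingHom.smooth_algebraMap] at h2
  infer_instance

theorem locallyOfFiniteType_specStr_iff {R : Type u} [CommRing R] [Algebra k R] :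
    LocallyOfFiniteType (specStr k R) ↔ Algebra.FiniteType k R :=
  (HasRingHomProperty.Spec_iff (P := @LocallyOfFiniteType)).trans RingHom.finiteType_algebraMap

/-- The formal arc theorem of Grinberg–Kazhdan and Drinfeld. -/
theorem formal_arc_theorem {X : Scheme.{u}} (s : X ⟶ Spec (.of k)) [LocallyOfFiniteType s]
    (γ₀ : Spec (.of k⟦X⟧) ⟶ X) (hγ₀ : γ₀ ≫ s = specStr k k⟦X⟧)
    (hsing : ¬ Set.range γ₀ ⊆ singularLocus s)
    (hiso : ¬ IsOpen {γ₀ (IsLocalRing.closedPoint k⟦X⟧)}) :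
    ∃ (Y : Scheme.{u}) (s' : Y ⟶ Spec (.of k)) (y : Spec (.of k) ⟶ Y),
      LocallyOfFiniteType s' ∧ QuasiCompact s' ∧ y ≫ s' = 𝟙 _ ∧
      Nonempty (arcFormalNbhd s γ₀ ≅
        FunctorToTypes.prod (formalNbhd s' y) (formalDiscPow k)) := by
  obtain ⟨R, j, _, hx, -⟩ := Scheme.exists_affine_mem_range_and_range_subset
    (TopologicalSpace.Opens.mem_top (γ₀ (IsLocalRing.closedPoint k⟦X⟧)))
  obtain ⟨φ, hφ⟩ := Spec.map_surjective (j ≫ s)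
  let _ : Algebra k R := φ.hom.toAlgebra
  have hj : j ≫ s = specStr k R := hφ.symm
  have : Algebra.FiniteType k R := by
    rw [← locallyOfFiniteType_specStr_iff, ← hj]
    infer_instance
  have hrange : Set.range γ₀ ⊆ Set.range j := by
    -- The spectrum of `k⟦t⟧` is local, so an open set containing the image of the closed point
    -- contains the whole arc.
    have h1 := Scheme.preimage_eq_top_of_closedPoint_mem γ₀ (U := j.opensRange) hx
    rintro _ ⟨x, rfl⟩
    exact (h1 ▸ TopologicalSpace.Opens.mem_top x : x ∈ γ₀ ⁻¹ᵁ j.opensRange)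
  have hlift := IsOpenImmersion.lift_fac j γ₀ hrange
  obtain ⟨γ, hγ⟩ := exists_specMap_eq (IsOpenImmersion.lift j γ₀ hrange) (by
    rw [← hj, ← Category.assoc, hlift, hγ₀])
  rw [← hγ] at hlift
  subst hlift
  obtain ⟨_, ⟨x, rfl⟩, hx⟩ := Set.not_subset.1 hsing
  rw [singularLocus, Set.mem_ofPred_eq, not_not] at hx
  obtain ⟨U, hxU, hU⟩ := hx
  obtain ⟨g, hg, _⟩ := exists_formallySmooth_localization s j hj hU hxU
  have hg0 : γ g ≠ 0 := by
    intro h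
    refine hg ?_
    change γ g ∈ x.asIdeal
    rw [h]
    exact Ideal.zero_mem _
  -- The chart is an open embedding, so a point isolated in the chart would be isolated in `X`.
  obtain ⟨B, _, _, b, _, ⟨α⟩⟩ := affine_formal_arc_theorem γ hg0 (fun h => hiso (by
    refine Eq.mp (congrArg IsOpen ?_) (j.isOpenEmbedding.isOpenMap _ h)
    exact Set.image_singleton))
  obtain ⟨β⟩ := nonempty_affineArcNbhd_iso_arcFormalNbhd s j hj γ
  refine ⟨_, specStr k B, specMap b, locallyOfFiniteType_specStr_iff.2 inferInstance, ?_, ?_,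
    ⟨β.symm ≪≫ α⟩⟩
  · rw [specStr]
    infer_instance
  · rw [specMap_str]
    exact Spec.map_id _

end SchemeArcs

end

theorem mainTheorem6 (k : Type u) [Field k] :
    (∀ (X : Scheme.{u}) (s : X ⟶ Spec (.of k)) [LocallyOfFiniteType s] [QuasiCompact s]
      (γ₀ : Spec (.of k⟦X⟧) ⟶ X),
      γ₀ ≫ s = specStr k k⟦X⟧ →
      ¬ Set.range γ₀ ⊆ singularLocus s →
      ¬ IsOpen {γ₀ (IsLocalRing.closedPoint k⟦X⟧)} →
      ∃ (Y : Scheme.{u}) (s' : Y ⟶ Spec (.of k)) (y : Spec (.of k) ⟶ Y),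
        LocallyOfFiniteType s' ∧ QuasiCompact s' ∧ y ≫ s' = 𝟙 _ ∧
        Nonempty (arcFormalNbhd s γ₀ ≅
          FunctorToTypes.prod (formalNbhd s' y) (formalDiscPow k))) ∧
    (∀ (n : ℕ) (f : MvPolynomial (Option (Fin n)) k) (x₀ : Fin n → k⟦X⟧) (y₀ : k⟦X⟧) (d r : ℕ),
      MvPolynomial.aeval (vec x₀ y₀) f = 0 →
      (MvPolynomial.aeval (vec x₀ y₀) (MvPolynomial.pderiv none f)).order = d →
      0 < d → 1 < r →
      ∃ (B : CommAlgCat.{u} k) (e : (tripleFunctor f d r).CorepresentableBy B) (b : B →ₐ[k] k),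
        Algebra.FiniteType k B ∧
        (e.homEquiv (CommAlgCat.ofHom b)).q = Polynomial.X ^ d ∧
        (∀ i, (e.homEquiv (CommAlgCat.ofHom b)).x i =
          PowerSeries.trunc ((r + 1) * d) (x₀ i)) ∧
        (e.homEquiv (CommAlgCat.ofHom b)).y = PowerSeries.trunc (r * d) y₀ ∧
        Nonempty (hypersurfaceArcFormalNbhd f x₀ y₀ ≅
          FunctorToTypes.prod
            (formalNbhd (specStr k B) (specMap b))
            (formalDiscPow k))) :=
  ⟨fun _ s _ _ γ₀ hγ₀ hsing hiso => formal_arc_theorem s γ₀ hγ₀ hsing hiso,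
    fun n f x₀ y₀ d r hf hd hd0 hr => hypersurface_formal_arc_theorem n f x₀ y₀ d r hf hd hd0 hr⟩
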